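/- \textbf{Capacitated domination.} An instance is a finite simple graph with a cost $w(v)\ge 0$, a capacity $c(v)>0$ and a demand $d(v)\ge 0$ on each vertex. A demand assignment $f\ge 0$ is \emph{feasible} if $\sum_{u\in N[v]}f(v,u)\ge d(v)$ for all $v$; its multiplicities are $x_f(u)=\big\lceil \sum_{v\in N[u]}f(v,u)/c(u)\big\rceil$ and its cost is $w(f)=\sum_u w(u)x_f(u)$. $OPT_f$ denotes the optimum of the linear program: minimize $\sum_u w(u)x(u)$ subject to $\sum_{v\in N[u]}f(u,v)\ge d(u)$, $\sum_{v\in N[u]}f(v,u)\le c(u)x(u)$, $f(v,u)\le d(v)x(u)$ for $v\in N[u]$, and $f,x\ge 0$. \textbf{The graph $\mathcal H_i$.} Let $\mathcal G$ be a connected instance with an outerplanar embedding (vertices on a circle, edges as non-crossing straight segments), and fix an anchor vertex $a$. Let $\mathcal L_\ell$ be the set of vertices at distance $\ell$ from $a$, and order the vertices counter-clockwise along the circle starting from $a$. For $0\le i<3$ put $\mathcal R_i=\bigcup_j\mathcal L_{3j+i}$. Keep only the edges incident to $\mathcal R_i$ and set the demands outside $\mathcal R_i$ to $0$; this gives $\mathcal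 G_i$. For $v\in\mathcal R_i\cap\mathcal L_\ell$ list $N[v]$ by ascending cost (ties arbitrary). Let $j_v$ be the first vertex of the list with $c(j_v)>d(v)$; let $k_v$ be a vertex of minimum ratio $w/c$ among those before $j_v$ (among all, if $j_v$ does not exist); let $p_v$ and $q_v$ be the largest vertices of $N[v]\cap\mathcal L_{\ell-1}$ and $N[v]\cap\mathcal L_{\ell+1}$ (each of the four when it exists). $\mathcal H_i$ arises from $\mathcal G_i$ by deleting, for each $v\in\mathcal R_i$, the edges from $v$ to the vertices of $N[v]\setminus(\mathcal L_\ell\cup\{j_v,k_v,p_v,q_v\})$. \textbf{Greedy-Charging} (on an instance). Keep a set $V^\phi$, initially $\{v:d(v)\ne 0\}$, slacks $w^\phi$, initially $w$, and sets $D^*(v)$, initially empty. Let $d^\phi(v)=\sum_{x\in N[v]\cap V^\phi}d(x)$; $v$ is heavily loaded if $d^\phi(v)>c(v)$ and lightly loaded otherwise. While $V^\phi\neq\emptyset$, pick $u$ with $d^\phi(u)>0$ minimizing $r_u=w^\phi(u)/\min\{c(u),d^\phi(u)\}$ (ties arbitrary; $u$ is \emph{saturated}) and decrease every $w^\phi(v)$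 by $r_u\min\{c(v),d^\phi(v)\}$. If $u$ is lightly loaded, assign to $u$ all demand from $N[u]\cap V^\phi$ and then as much still unassigned demand from $D^*(u)$ as fits into the remaining capacity $c(u)-d^\phi(u)$; otherwise mark $u$ as heavy. Remove $N[u]$ from $V^\phi$; for each $v$ that thereby turns from heavily to lightly loaded, let $D^*(v)$ be $N[v]\cap V^\phi$ with $V^\phi$ taken before the removal. At the end, for the heavy vertices in the order of saturation, assign all still unassigned demand from $N[u]$ to $u$. \textbf{Lemma.} On every such $\mathcal H_i$ the algorithm Greedy-Charging has a complete run, and the output $f_0$ of every complete run (whatever choices are made in the reduction and in the run) can be modified as follows: there is a feasible demand assignment $f^*$ of $\mathcal H_i$ which assigns demand only to vertices saturated during the run, uses at most one copy of every vertex that was lightly loaded when saturated, and satisfies $$w(f^*)\le w(f_0)\qquad\text{and}\qquad w(f^*)\le 6\cdot OPT_f(\mathcal H_i).$$ -/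

import Mathlib

open scoped BigOperators

noncomputable section

/-- The closed neighbourhood `N[v]` of `v` in `G`. -/
def closedNbhd {V : Type*} [Fintype V] (G : SimpleGraph V) (v : V) : Finset V :=
  open scoped Classical in Finset.univ.filter fun u => u = v ∨ G.Adj v u

/-- An instance of capacitated domination: a simple graph whose vertices carry a non-negative cost,
a capacity and a non-negative demand.  Capacities are positive, since the multiplicity of a vertex
is obtained by dividing by its capacity. -/
structure CapDom (V : Type*) where
  graph : SimpleGraph V
  w : V → ℝ
  c : V → ℝ
  d : V → ℝ
  w_nonneg : ∀ v, 0 ≤ w v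
  c_pos : ∀ v, 0 < c v
  d_nonneg : ∀ v, 0 ≤ d v

namespace CapDom

variable {V : Type*} [Fintype V]

/-- The closed neighbourhood in the graph of the instance. -/
def nbhd (I : CapDom V) (v : V) : Finset V := closedNbhd I.graph v

/-- `f v u` is the amount of the demand of `v` that is assigned to `u`.  The function is feasible
if it is non-negative and the demand of every vertex is assigned to its closed neighbours. -/
def IsFeasible (I : CapDom V) (f : V → V → ℝ) : Prop :=
  (∀ v u, 0 ≤ f v u) ∧ ∀ v, I.d v ≤ ∑ u ∈ I.nbhd v, f v u

/-- The multiplicity `x_f(u) = ⌈(∑_{v ∈ N[u]} f(v,u)) / c(u)⌉`. -/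
def multiplicity (I : CapDom V) (f : V → V → ℝ) (u : V) : ℕ :=
  ⌈(∑ v ∈ I.nbhd u, f v u) / I.c u⌉₊

/-- The cost `w(f) = ∑_u w(u) x_f(u)`. -/
def cost (I : CapDom V) (f : V → V → ℝ) : ℝ :=
  ∑ u, I.w u * (I.multiplicity f u : ℝ)

/-- Feasible solutions `(f, x)` of the linear relaxation of the integer program. -/
structure IsFractional (I : CapDom V) (f : V → V → ℝ) (x : V → ℝ) : Prop where
  covers : ∀ u, 0 ≤ ∑ v ∈ I.nbhd u, f u v - I.d u
  capacity : ∀ u, 0 ≤ I.c u * x u - ∑ v ∈ I.nbhd u, f v u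
  local_bound : ∀ u, ∀ v ∈ I.nbhd u, 0 ≤ I.d v * x u - f v u
  f_nonneg : ∀ u v, 0 ≤ f u v
  x_nonneg : ∀ u, 0 ≤ x u

/-- The optimal value `OPT_f` of the linear relaxation. -/
def optFractional (I : CapDom V) : ℝ :=
  sInf {r : ℝ | ∃ f x, I.IsFractional f x ∧ r = ∑ u, I.w u * x u}

end CapDom

/-- An outerplanar embedding: the vertices are distinct points of the unit circle, the edges are
drawn as straight segments, and two edges meet only in common endpoints. -/
structure OuterplanarEmbedding {V : Type*} (G : SimpleGraph V) where
  pos : V → Circle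
  pos_injective : Function.Injective pos
  edges_meet_at_ends : ∀ a b a' b', G.Adj a b → G.Adj a' b' → s(a, b) ≠ s(a', b') →
    segment ℝ (pos a : ℂ) (pos b : ℂ) ∩ segment ℝ (pos a' : ℂ) (pos b' : ℂ) ⊆
      (fun v => (pos v : ℂ)) '' (({a, b} : Set V) ∩ {a', b'})

/-- The angle in `[0, 2π)` through which one travels counter-clockwise along the circle from the
anchor to `v`.  Its values order the vertices by their appearance on the outer face, traversed
counter-clockwise from the anchor. -/
def OuterplanarEmbedding.ccwAngle {V : Type*} {G : SimpleGraph V} (E : OuterplanarEmbedding G)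
    (anchor v : V) : ℝ :=
  toIcoMod Real.two_pi_pos 0 (Complex.arg ((E.pos v / E.pos anchor : Circle) : ℂ))

namespace CapDom

variable {V : Type*} [Fintype V]

/-- `R_i`: the vertices in the layers `i, i + 3, i + 6, …`, where the layer of a vertex is its
distance to the anchor. -/
def classR (I : CapDom V) (anchor : V) (i : ℕ) : Set V :=
  {v | I.graph.dist anchor v % 3 = i}

/-- `G_i`: only the edges incident to `R_i` are kept and the demands outside `R_i` are set to zero.
A vertex that is not in the closed neighbourhood of `R_i` stays in the type `V` as an isolated
vertex without demand; it has no influence on the problem. -/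
def layered (I : CapDom V) (anchor : V) (i : ℕ) : CapDom V where
  graph :=
    { Adj := fun a b => I.graph.Adj a b ∧ (a ∈ I.classR anchor i ∨ b ∈ I.classR anchor i)
      symm := ⟨fun _ _ h => ⟨h.1.symm, h.2.symm⟩⟩
      loopless := ⟨fun _ h => h.1.ne rfl⟩ }
  w := I.w
  c := I.c
  d := (I.classR anchor i).indicator I.d
  w_nonneg := I.w_nonneg
  c_pos := I.c_pos
  d_nonneg := fun v => Set.indicator_nonneg (fun x _ => I.d_nonneg x) v

/-- The vertices of a list that precede the first one of capacity greater than `d v`. -/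
def cheapPrefix (I : CapDom V) (l : List V) (v : V) : List V :=
  open scoped Classical in l.takeWhile fun x => decide (I.c x ≤ I.d v)

/-- The choices made in the reduction: for every `v`, an enumeration `π_v` of `N[v]` by ascending
cost, and, if there is a vertex before `j_v`, one of them, `k_v`, with minimum ratio of cost to
capacity. -/
structure ReductionChoice (I : CapDom V) where
  enum : V → List V
  enum_nodup : ∀ v, (enum v).Nodup
  mem_enum : ∀ v x, x ∈ enum v ↔ x ∈ I.nbhd v
  enum_sorted : ∀ v, (enum v).Pairwise fun x y => I.w x ≤ I.w y
  best : V → V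
  best_mem : ∀ v, I.cheapPrefix (enum v) v ≠ [] → best v ∈ I.cheapPrefix (enum v) v
  best_le : ∀ v, ∀ x ∈ I.cheapPrefix (enum v) v, I.w (best v) / I.c (best v) ≤ I.w x / I.c x

/-- `x = j_v`: the first vertex of the enumeration with capacity greater than `d v`. -/
def IsFirstLarge (I : CapDom V) (C : I.ReductionChoice) (v x : V) : Prop :=
  open scoped Classical in (C.enum v).find? (fun y => decide (I.d v < I.c y)) = some x

/-- `x = k_v`; there is no such vertex if `j_v` comes first in the enumeration. -/
def IsBestRatio (I : CapDom V) (C : I.ReductionChoice) (v x : V) : Prop :=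
  I.cheapPrefix (C.enum v) v ≠ [] ∧ x = C.best v

/-- `x = p_v`: the largest vertex of `N[v]` in the preceding layer. -/
def IsLastUp (I : CapDom V) (E : OuterplanarEmbedding I.graph) (anchor v x : V) : Prop :=
  IsGreatest (E.ccwAngle anchor '' {y | y ∈ I.nbhd v ∧
      I.graph.dist anchor y + 1 = I.graph.dist anchor v}) (E.ccwAngle anchor x) ∧
    x ∈ I.nbhd v ∧ I.graph.dist anchor x + 1 = I.graph.dist anchor v

/-- `x = q_v`: the largest vertex of `N[v]` in the following layer. -/
def IsLastDown (I : CapDom V) (E : OuterplanarEmbedding I.graph) (anchor v x : V) : Prop :=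
  IsGreatest (E.ccwAngle anchor '' {y | y ∈ I.nbhd v ∧
      I.graph.dist anchor y = I.graph.dist anchor v + 1}) (E.ccwAngle anchor x) ∧
    x ∈ I.nbhd v ∧ I.graph.dist anchor x = I.graph.dist anchor v + 1

/-- `R(v)`: the closed neighbours of `v` which are neither in the layer of `v` nor equal to one of
`j_v`, `k_v`, `p_v`, `q_v`. -/
def removed (I : CapDom V) (E : OuterplanarEmbedding I.graph) (anchor : V)
    (C : I.ReductionChoice) (v : V) : Set V :=
  {x | x ∈ I.nbhd v ∧ I.graph.dist anchor x ≠ I.graph.dist anchor v ∧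
    ¬ I.IsFirstLarge C v x ∧ ¬ I.IsBestRatio C v x ∧
    ¬ I.IsLastUp E anchor v x ∧ ¬ I.IsLastDown E anchor v x}

/-- `H_i`: the edges of `G_i` between `v` and `R(v)` are deleted, for all `v ∈ R_i`. -/
def reduced (I : CapDom V) (E : OuterplanarEmbedding I.graph) (anchor : V) (i : ℕ)
    (C : I.ReductionChoice) : CapDom V :=
  { I.layered anchor i with
    graph := (I.layered anchor i).graph.deleteEdges
      {e | ∃ v ∈ I.classR anchor i, ∃ x ∈ I.removed E anchor C v, e = s(x, v)} }

end CapDom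

/-- The state of the greedy-charging algorithm. -/
structure GreedyState (V : Type*) where
  /-- `V^φ`: the vertices that are still to be served. -/
  unserved : Finset V
  /-- `w^φ(v)`: the part of the cost `w(v)` that is not yet paid by the dual variables. -/
  slack : V → ℝ
  /-- `D^*(v)` -/
  late : V → Finset V
  /-- The demand assigned so far. -/
  assign : V → V → ℝ
  /-- The vertices that were lightly loaded when they were saturated. -/
  light : Finset V
  /-- The vertices marked as heavy, in the order in which they were saturated. -/
  heavy : List V

namespace CapDom

variable {V : Type*} [Fintype V]

/-- `d^φ(u)`: the demand of the closed neighbours of `u` that are still to be served.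
The vertex `u` is heavily loaded if this exceeds `c(u)`, and lightly loaded otherwise. -/
def pending (I : CapDom V) (s : GreedyState V) (u : V) : ℝ :=
  open scoped Classical in ∑ v ∈ I.nbhd u ∩ s.unserved, I.d v

/-- The demand of `v` that is not assigned by `f`. -/
def residual (I : CapDom V) (f : V → V → ℝ) (v : V) : ℝ :=
  I.d v - ∑ u ∈ I.nbhd v, f v u

/-- `r_v`: the further time after which `v` is saturated if the loads stay as they are. -/
def saturationTime (I : CapDom V) (s : GreedyState V) (v : V) : ℝ :=
  s.slack v / min (I.c v) (I.pending s v)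

/-- The initial state. -/
def greedyInit (I : CapDom V) : GreedyState V where
  unserved := open scoped Classical in Finset.univ.filter fun v => I.d v ≠ 0
  slack := I.w
  late := fun _ => ∅
  assign := fun _ _ => 0
  light := ∅
  heavy := []

/-- The demand `a v` that a lightly loaded vertex `u` receives from `v` when it is saturated: all of
the demand from `N[u] ∩ V^φ`, and then as much unassigned demand from `D^*(u)` as fits into the
remaining capacity. -/
structure IsLightService (I : CapDom V) (s : GreedyState V) (u : V) (a : V → ℝ) : Prop where
  unserved : ∀ v ∈ I.nbhd u, v ∈ s.unserved → a v = I.residual s.assign v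
  late : ∀ v ∈ s.late u, v ∉ s.unserved → 0 ≤ a v ∧ a v ≤ I.residual s.assign v
  other : ∀ v, ¬ (v ∈ I.nbhd u ∧ v ∈ s.unserved) → ¬ (v ∈ s.late u ∧ v ∉ s.unserved) → a v = 0
  total : open scoped Classical in ∑ v ∈ s.late u \ s.unserved, a v =
    min (I.c u - I.pending s u) (∑ v ∈ s.late u \ s.unserved, I.residual s.assign v)

/-- One iteration of the main loop: the vertex `u`, the next one to be saturated, is processed and
the state `s` becomes `t`. -/
structure GreedyStep (I : CapDom V) (s : GreedyState V) (u : V) (t : GreedyState V) : Prop where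
  pending_pos : 0 < I.pending s u
  first : ∀ v, 0 < I.pending s v → I.saturationTime s u ≤ I.saturationTime s v
  slack : ∀ v, t.slack v = s.slack v - I.saturationTime s u * min (I.c v) (I.pending s v)
  unserved : ∀ v, v ∈ t.unserved ↔ v ∈ s.unserved ∧ v ∉ I.nbhd u
  /-- For a vertex `v` that becomes lightly loaded, `D^*(v)` is `N[v] ∩ (V^φ ∪ Q_u)`, where `V^φ`
  is the updated set and `Q_u` consists of the vertices removed from it in this iteration. -/
  late_new : ∀ v, I.c v < I.pending s v → I.pending t v ≤ I.c v →
    ∀ x, x ∈ t.late v ↔ x ∈ I.nbhd v ∧ (x ∈ t.unserved ∨ (x ∈ I.nbhd u ∧ x ∈ s.unserved))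
  late_old : ∀ v, ¬ (I.c v < I.pending s v ∧ I.pending t v ≤ I.c v) → t.late v = s.late v
  light_case : I.pending s u ≤ I.c u →
    t.heavy = s.heavy ∧ (∀ v, v ∈ t.light ↔ v = u ∨ v ∈ s.light) ∧
    ∃ a, I.IsLightService s u a ∧ (∀ v, t.assign v u = s.assign v u + a v) ∧
      ∀ v z, z ≠ u → t.assign v z = s.assign v z
  heavy_case : I.c u < I.pending s u →
    t.heavy = s.heavy ++ [u] ∧ t.light = s.light ∧ t.assign = s.assign

/-- A complete run of the main loop, ending in the state `s`. -/
def GreedyRun (I : CapDom V) (s : GreedyState V) : Prop :=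
  Relation.ReflTransGen (fun s₁ s₂ => ∃ u, I.GreedyStep s₁ u s₂) I.greedyInit s ∧ s.unserved = ∅

/-- All unassigned demand from `N[u]` is assigned to `u`. -/
def serveAll (I : CapDom V) (f : V → V → ℝ) (u : V) : V → V → ℝ :=
  open scoped Classical in
  fun v z => if z = u ∧ v ∈ I.nbhd u then f v z + I.residual f v else f v z

/-- The demand assignment returned by the greedy-charging algorithm: after the main loop, the
vertices marked as heavy are served in the order in which they were saturated. -/
def greedyOutput (I : CapDom V) (s : GreedyState V) : V → V → ℝ :=
  s.heavy.foldl I.serveAll s.assign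

end CapDom

end

noncomputable section

namespace CapDom

variable {V : Type*} [Fintype V]

/-! Greedy-Charging is a primal-dual algorithm. Let the clock advance by `r_u` in each step and let
`y v` be the time at which `v` leaves `V^φ`. Meanwhile the slack of `u` falls at rate `min (c u)
(pending u)`, and by the capacity and local bounds no LP column `(f, x)` at `u` collects `∑ f v * y
v` faster than `x` times this rate. So `y` is dual feasible and `∑ d v * y v ≤ OPT_f`
(`GreedyStep.dualInv`, `DualInv.sum_le_optFractional`).

It remains to find an assignment that charges each `v` at most `6 * d v * y v`
(`exists_admissible_le_six`). The run yields shares `room u v ≤ d v` with `∑ room u v ≤ c u` and,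
for saturated `u`, `w u = ∑ room u v * y v`: whatever pays for `u` also fits into one copy of it.
The demand of `v` is spread over its light neighbours within these shares, and only the overflow
goes to its heavy server. If the shares at the light neighbours add up to `A`, the charge in units
of `y v` is at most `max (d v) A` plus `d v` for the rounded-up copy at the server. Six saturated
neighbours, one of them the heavy server, thus cost at most `6 * d v`. Seven are affordable if the
server of `v` can receive demand from `v` only: without overflow it is not used, and with overflow
`A < d v`.

The graph guarantees this condition (`reduced_isSparse`, `DualInv.card_saturated_le`). By
outerplanarity a vertex has at most two neighbours in its layer, and the reduction keeps at most
four others, so `N[v]` has at most seven elements. If it has seven, at least two are in the next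
layer. If none of the closed neighbours is private to `v`, two of these children are shared with the
left and the right layer neighbour of `v` respectively, and then `v` and these two children cannot
all be saturated.

The cheaper of this assignment and `f_0` satisfies both cost bounds. -/

theorem mem_nbhd {I : CapDom V} {v u : V} : u ∈ I.nbhd v ↔ u = v ∨ I.graph.Adj v u := by
  classical
  simp [nbhd, closedNbhd]

theorem mem_nbhd_comm {I : CapDom V} {v u : V} : u ∈ I.nbhd v ↔ v ∈ I.nbhd u := by
  rw [mem_nbhd, mem_nbhd, I.graph.adj_comm, eq_comm]

theorem self_mem_nbhd {I : CapDom V} (v : V) : v ∈ I.nbhd v := mem_nbhd.2 (Or.inl rfl)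

/-- A vertex has been saturated if it was served lightly or marked as heavy. -/
def IsSaturated (s : GreedyState V) (u : V) : Prop := u ∈ s.light ∨ u ∈ s.heavy

open scoped Classical in
theorem pending_eq {I : CapDom V} {s : GreedyState V} {u : V} :
    I.pending s u = ∑ v ∈ I.nbhd u, if v ∈ s.unserved then I.d v else 0 := by
  rw [pending, ← Finset.sum_filter, Finset.filter_mem_eq_inter]

theorem pending_nonneg (I : CapDom V) (s : GreedyState V) (u : V) : 0 ≤ I.pending s u :=
  Finset.sum_nonneg fun v _ => I.d_nonneg v

theorem pending_eq_zero {I : CapDom V} {s : GreedyState V} {u : V}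
    (h : ∀ v ∈ I.nbhd u, v ∉ s.unserved) : I.pending s u = 0 := by
  classical
  rw [pending_eq]
  exact Finset.sum_eq_zero fun v hv => if_neg (h v hv)

theorem exists_unserved {I : CapDom V} {s : GreedyState V} {u : V} (h : 0 < I.pending s u) :
    ∃ v ∈ I.nbhd u, v ∈ s.unserved := by
  by_contra! hc
  exact h.ne' (pending_eq_zero hc)

theorem GreedyStep.unserved_subset {I : CapDom V} {s t : GreedyState V} {u : V}
    (h : I.GreedyStep s u t) : t.unserved ⊆ s.unserved := fun v hv => ((h.unserved v).1 hv).1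

theorem pending_mono {I : CapDom V} {s t : GreedyState V} (h : t.unserved ⊆ s.unserved) (u : V) :
    I.pending t u ≤ I.pending s u := by
  classical
  exact Finset.sum_le_sum_of_subset_of_nonneg (Finset.inter_subset_inter_left h)
    fun v _ _ => I.d_nonneg v

/-! ### Feasibility of the assignment during the run and of the output -/

/-- The invariants of the main loop that concern the demand assignment. -/
structure PrimalInv (I : CapDom V) (s : GreedyState V) : Prop where
  demand : ∀ v ∈ s.unserved, I.d v ≠ 0
  assign_nonneg : ∀ v u, 0 ≤ s.assign v u
  residual_nonneg : ∀ v, 0 ≤ I.residual s.assign v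
  assign_unserved : ∀ v ∈ s.unserved, ∀ u, s.assign v u = 0
  assign_light : ∀ v u, s.assign v u ≠ 0 → u ∈ s.light
  late_subset : ∀ u, s.late u ⊆ I.nbhd u
  saturated : ∀ u, IsSaturated s u → ∀ v ∈ I.nbhd u, v ∉ s.unserved
  disjoint : ∀ u ∈ s.light, u ∉ s.heavy
  load_le : ∀ u ∈ s.light, ∑ v ∈ I.nbhd u, s.assign v u ≤ I.c u
  served : ∀ v, I.d v ≠ 0 → v ∉ s.unserved →
    I.residual s.assign v = 0 ∨ ∃ h ∈ s.heavy, v ∈ I.nbhd h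

theorem primalInv_init (I : CapDom V) : I.PrimalInv I.greedyInit where
  demand := by simp [greedyInit]
  assign_nonneg := by simp [greedyInit]
  residual_nonneg := by simp [greedyInit, residual, I.d_nonneg]
  assign_unserved := by simp [greedyInit]
  assign_light := by simp [greedyInit]
  late_subset := by simp [greedyInit]
  saturated := by simp [greedyInit, IsSaturated]
  disjoint := by simp [greedyInit]
  load_le := by simp [greedyInit]
  served := by simp +contextual [greedyInit]

theorem GreedyStep.not_saturated {I : CapDom V} {s t : GreedyState V} {u : V}
    (h : I.GreedyStep s u t) (hs : I.PrimalInv s) : ¬ IsSaturated s u := fun hu =>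
  h.pending_pos.ne' (pending_eq_zero (hs.saturated u hu))

theorem GreedyStep.saturated_iff {I : CapDom V} {s t : GreedyState V} {u : V}
    (h : I.GreedyStep s u t) (v : V) : IsSaturated t v ↔ v = u ∨ IsSaturated s v := by
  rcases le_or_gt (I.pending s u) (I.c u) with hl | hl
  · obtain ⟨h1, h2, -⟩ := h.light_case hl
    simp [IsSaturated, h1, h2, or_assoc]
  · obtain ⟨h1, h2, -⟩ := h.heavy_case hl
    simp only [IsSaturated, h1, h2, List.mem_append, List.mem_singleton]
    tauto

theorem residual_update {I : CapDom V} {f g : V → V → ℝ} {u v : V} {x : ℝ}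
    (hu : u ∈ I.nbhd v) (h : g v u = f v u + x) (h' : ∀ z, z ≠ u → g v z = f v z) :
    I.residual g v = I.residual f v - x := by
  classical
  have h1 : ∑ z ∈ I.nbhd v, (g v z - f v z) = x := by
    rw [Finset.sum_eq_single u (fun z _ hz => by rw [h' z hz, sub_self]) fun hn => absurd hu hn, h]
    ring
  rw [Finset.sum_sub_distrib] at h1
  unfold residual
  linarith

theorem IsLightService.mem_nbhd {I : CapDom V} {s : GreedyState V} {u : V} {a : V → ℝ}
    (ha : I.IsLightService s u a) (hs : I.PrimalInv s) {v : V} (hv : v ∉ I.nbhd u) : a v = 0 :=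
  ha.other v (fun h => hv h.1) fun h => hv (hs.late_subset u h.1)

theorem IsLightService.bounds {I : CapDom V} {s : GreedyState V} {u : V} {a : V → ℝ}
    (ha : I.IsLightService s u a) (hs : I.PrimalInv s) (v : V) :
    0 ≤ a v ∧ a v ≤ I.residual s.assign v := by
  by_cases h1 : v ∈ I.nbhd u ∧ v ∈ s.unserved
  · rw [ha.unserved v h1.1 h1.2]
    exact ⟨hs.residual_nonneg v, le_rfl⟩
  · by_cases h2 : v ∈ s.late u ∧ v ∉ s.unserved
    · exact ha.late v h2.1 h2.2
    · rw [ha.other v h1 h2]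
      exact ⟨le_rfl, hs.residual_nonneg v⟩

theorem PrimalInv.residual_unserved {I : CapDom V} {s : GreedyState V} (hs : I.PrimalInv s) {v : V}
    (hv : v ∈ s.unserved) : I.residual s.assign v = I.d v := by
  simp [residual, hs.assign_unserved v hv]

theorem IsLightService.sum_le {I : CapDom V} {s : GreedyState V} {u : V} {a : V → ℝ}
    (ha : I.IsLightService s u a) (hs : I.PrimalInv s) : ∑ v ∈ I.nbhd u, a v ≤ I.c u := by
  classical
  have h1 : ∑ v ∈ I.nbhd u ∩ s.unserved, a v = I.pending s u := by
    unfold pending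
    refine Finset.sum_congr rfl fun v hv => ?_
    rw [Finset.mem_inter] at hv
    rw [ha.unserved v hv.1 hv.2, hs.residual_unserved hv.2]
  have h2 : ∑ v ∈ I.nbhd u \ s.unserved, a v = ∑ v ∈ s.late u \ s.unserved, a v := by
    symm
    refine Finset.sum_subset (Finset.sdiff_subset_sdiff (hs.late_subset u) le_rfl) fun v hv hv' => ?_
    simp only [Finset.mem_sdiff] at hv hv'
    exact ha.other v (fun h => hv.2 h.2) hv'
  have h3 := Finset.sum_inter_add_sum_sdiff (I.nbhd u) s.unserved a
  have h4 := ha.total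
  have h5 := min_le_left (I.c u - I.pending s u) (∑ v ∈ s.late u \ s.unserved, I.residual s.assign v)
  linarith

theorem GreedyStep.late_subset {I : CapDom V} {s t : GreedyState V} {u : V}
    (h : I.GreedyStep s u t) (hs : ∀ v, s.late v ⊆ I.nbhd v) (v : V) : t.late v ⊆ I.nbhd v := by
  by_cases hv : I.c v < I.pending s v ∧ I.pending t v ≤ I.c v
  · exact fun x hx => ((h.late_new v hv.1 hv.2 x).1 hx).1
  · rw [h.late_old v hv]
    exact hs v

theorem GreedyStep.primalInv {I : CapDom V} {s t : GreedyState V} {u : V}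
    (h : I.GreedyStep s u t) (hs : I.PrimalInv s) : I.PrimalInv t := by
  have hnot := h.not_saturated hs
  have hsat : ∀ x, IsSaturated t x → ∀ v ∈ I.nbhd x, v ∉ t.unserved := by
    intro x hx v hv hvt
    rw [h.unserved] at hvt
    rcases (h.saturated_iff x).1 hx with rfl | hx
    · exact hvt.2 hv
    · exact hs.saturated x hx v hv hvt.1
  rcases le_or_gt (I.pending s u) (I.c u) with hl | hl
  · obtain ⟨hh, hlight, a, ha, hau, haz⟩ := h.light_case hl
    -- Nothing was assigned to `u` before its saturation, so its load after this step is exactly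
    -- `a`.
    have hz : ∀ v, s.assign v u = 0 := fun v => by
      by_contra hc
      exact hnot (Or.inl (hs.assign_light v u hc))
    have hres : ∀ v, I.residual t.assign v = I.residual s.assign v - a v := fun v => by
      by_cases hv : v ∈ I.nbhd u
      · exact residual_update (mem_nbhd_comm.1 hv) (hau v) (haz v)
      · rw [ha.mem_nbhd hs hv, sub_zero]
        unfold residual
        congr 1
        exact Finset.sum_congr rfl fun z hz => haz v z fun hzu =>
          hv (mem_nbhd_comm.1 (hzu ▸ hz))
    refine ⟨fun v hv => hs.demand v (h.unserved_subset hv), fun v z => ?_, fun v => ?_,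
      fun v hv z => ?_, fun v z hvz => ?_, h.late_subset hs.late_subset, hsat, fun z hz' => ?_,
      fun z hz' => ?_, fun v hd hv => ?_⟩
    · by_cases hzu : z = u
      · rw [hzu, hau, hz v, zero_add]
        exact (ha.bounds hs v).1
      · rw [haz v z hzu]
        exact hs.assign_nonneg v z
    · rw [hres]
      linarith [(ha.bounds hs v).2]
    · have hv' := (h.unserved v).1 hv
      by_cases hzu : z = u
      · rw [hzu, hau, hz v, ha.mem_nbhd hs hv'.2, add_zero]
      · rw [haz v z hzu]
        exact hs.assign_unserved v hv'.1 z
    · rw [hlight]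
      by_cases hzu : z = u
      · exact Or.inl hzu
      · rw [haz v z hzu] at hvz
        exact Or.inr (hs.assign_light v z hvz)
    · rw [hh]
      rcases (hlight z).1 hz' with rfl | hz'
      · exact fun hc => hnot (Or.inr hc)
      · exact hs.disjoint z hz'
    · by_cases hzu : z = u
      · subst hzu
        simp only [hau, hz, zero_add]
        exact ha.sum_le hs
      · rw [Finset.sum_congr rfl fun v _ => haz v z hzu]
        exact hs.load_le z (((hlight z).1 hz').resolve_left hzu)
    · by_cases hvs : v ∈ s.unserved
      · left
        have hvu : v ∈ I.nbhd u := by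
          by_contra hc
          exact hv ((h.unserved v).2 ⟨hvs, hc⟩)
        rw [hres, ha.unserved v hvu hvs, sub_self]
      · rw [hh]
        refine (hs.served v hd hvs).imp_left fun h0 => ?_
        have := ha.bounds hs v
        rw [hres]
        linarith
  · obtain ⟨hh, hlight, hass⟩ := h.heavy_case hl
    refine ⟨fun v hv => hs.demand v (h.unserved_subset hv), ?_, ?_, ?_, ?_,
      h.late_subset hs.late_subset, hsat, fun z hz => ?_, ?_, fun v hd hv => ?_⟩
    · rw [hass]; exact hs.assign_nonneg
    · rw [hass]; exact hs.residual_nonneg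
    · rw [hass]; exact fun v hv => hs.assign_unserved v (h.unserved_subset hv)
    · rw [hass, hlight]; exact hs.assign_light
    · rw [hlight] at hz
      rw [hh, List.mem_append, List.mem_singleton]
      rintro (hc | rfl)
      · exact hs.disjoint z hz hc
      · exact hnot (Or.inl hz)
    · rw [hass, hlight]; exact hs.load_le
    · rw [hass, hh]
      by_cases hvs : v ∈ s.unserved
      · refine Or.inr ⟨u, by simp, ?_⟩
        by_contra hc
        exact hv ((h.unserved v).2 ⟨hvs, hc⟩)
      · refine (hs.served v hd hvs).imp_right ?_
        rintro ⟨x, hx, hvx⟩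
        exact ⟨x, by simp [hx], hvx⟩

theorem serveAll_residual (I : CapDom V) (f : V → V → ℝ) (u v : V) :
    (v ∈ I.nbhd u → I.residual (I.serveAll f u) v = 0) ∧
    (v ∉ I.nbhd u → I.residual (I.serveAll f u) v = I.residual f v) := by
  constructor
  · intro hv
    rw [residual_update (f := f) (g := I.serveAll f u) (u := u) (x := I.residual f v)
      (mem_nbhd_comm.1 hv) (by simp [serveAll, hv]) fun z hz => by simp [serveAll, hz], sub_self]
  · intro hv
    simp [residual, serveAll, hv]

/-- A residual that is zero stays zero under later services, so feasibility does not depend on the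
order of `l`. The last clause keeps the loads of the light vertices. -/
theorem foldl_serveAll (I : CapDom V) (l : List V) (f : V → V → ℝ) (hf : ∀ v u, 0 ≤ f v u)
    (hr : ∀ v, 0 ≤ I.residual f v) :
    (∀ v u, 0 ≤ l.foldl I.serveAll f v u) ∧ (∀ v, 0 ≤ I.residual (l.foldl I.serveAll f) v) ∧
    (∀ v, (I.residual f v = 0 ∨ ∃ h ∈ l, v ∈ I.nbhd h) →
      I.residual (l.foldl I.serveAll f) v = 0) ∧
    ∀ v u, u ∉ l → l.foldl I.serveAll f v u = f v u := by
  induction l generalizing f with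
  | nil => simpa using ⟨hf, hr⟩
  | cons x l ih =>
    have h1 : ∀ v u, 0 ≤ I.serveAll f x v u := fun v u => by
      unfold serveAll
      split_ifs
      · exact add_nonneg (hf v u) (hr v)
      · exact hf v u
    have h2 : ∀ v, 0 ≤ I.residual (I.serveAll f x) v := fun v => by
      by_cases hv : v ∈ I.nbhd x
      · rw [(serveAll_residual I f x v).1 hv]
      · rw [(serveAll_residual I f x v).2 hv]
        exact hr v
    obtain ⟨h3, h4, h5, h6⟩ := ih (I.serveAll f x) h1 h2
    refine ⟨h3, h4, fun v hv => h5 v ?_, fun v u hu => ?_⟩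
    · by_cases hvx : v ∈ I.nbhd x
      · exact Or.inl ((serveAll_residual I f x v).1 hvx)
      · rw [(serveAll_residual I f x v).2 hvx]
        refine hv.imp_right ?_
        rintro ⟨h, hh, hvh⟩
        rcases List.mem_cons.1 hh with rfl | hh
        · exact absurd hvh hvx
        · exact ⟨h, hh, hvh⟩
    · rw [List.mem_cons, not_or] at hu
      rw [List.foldl_cons, h6 v u hu.2]
      simp [serveAll, hu.1]

/-- The requirements on the modified assignment other than the bounds on its cost. -/
structure IsAdmissible (I : CapDom V) (s : GreedyState V) (f : V → V → ℝ) : Prop where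
  feasible : I.IsFeasible f
  support : ∀ v u, f v u ≠ 0 → u ∈ s.light ∨ u ∈ s.heavy
  light : ∀ u ∈ s.light, I.multiplicity f u ≤ 1

theorem multiplicity_le_one {I : CapDom V} {f : V → V → ℝ} {u : V}
    (h : ∑ v ∈ I.nbhd u, f v u ≤ I.c u) : I.multiplicity f u ≤ 1 := by
  unfold multiplicity
  rw [Nat.ceil_le, Nat.cast_one, div_le_one (I.c_pos u)]
  exact h

theorem PrimalInv.isAdmissible_greedyOutput {I : CapDom V} {s : GreedyState V}
    (hs : I.PrimalInv s) (hfin : s.unserved = ∅) : I.IsAdmissible s (I.greedyOutput s) := by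
  obtain ⟨h1, h2, h3, h4⟩ := foldl_serveAll I s.heavy s.assign hs.assign_nonneg hs.residual_nonneg
  refine ⟨⟨h1, fun v => ?_⟩, fun v u hvu => ?_, fun u hu => ?_⟩
  · by_cases hd : I.d v = 0
    · rw [hd]
      exact Finset.sum_nonneg fun u _ => h1 v u
    · have := h3 v (hs.served v hd (by simp [hfin]))
      exact (sub_eq_zero.1 this).le
  · by_contra! hc
    refine hvu ?_
    rw [greedyOutput, h4 v u hc.2]
    by_contra hn
    exact hc.1 (hs.assign_light v u hn)
  · refine multiplicity_le_one ?_
    exact (Finset.sum_congr rfl fun v _ => h4 v u (hs.disjoint u hu)).trans_le (hs.load_le u hu)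

/-! ### Existence of a complete run -/

/-- Only the total taken from `D^*(u)` is prescribed; the same proportion `m / S` of every residual
attains it. -/
theorem PrimalInv.exists_isLightService {I : CapDom V} {s : GreedyState V} (hs : I.PrimalInv s)
    {u : V} (hu : I.pending s u ≤ I.c u) : ∃ a, I.IsLightService s u a := by
  classical
  set S : ℝ := ∑ v ∈ s.late u \ s.unserved, I.residual s.assign v with hS
  set m : ℝ := min (I.c u - I.pending s u) S with hm
  have hS0 : 0 ≤ S := Finset.sum_nonneg fun v _ => hs.residual_nonneg v
  have hm0 : 0 ≤ m := le_min (sub_nonneg.2 hu) hS0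
  have hmS : m ≤ S := min_le_right _ _
  have hq1 : m / S ≤ 1 := div_le_one_of_le₀ hmS hS0
  have hq0 : 0 ≤ m / S := div_nonneg hm0 hS0
  refine ⟨fun v => if v ∈ I.nbhd u ∧ v ∈ s.unserved then I.residual s.assign v else
    if v ∈ s.late u ∧ v ∉ s.unserved then m / S * I.residual s.assign v else 0,
    fun v h1 h2 => if_pos ⟨h1, h2⟩, fun v h1 h2 => ?_, fun v h1 h2 => ?_, ?_⟩
  · rw [if_neg fun h => h2 h.2, if_pos ⟨h1, h2⟩]
    have := hs.residual_nonneg v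
    exact ⟨mul_nonneg hq0 this, mul_le_of_le_one_left this hq1⟩
  · rw [if_neg h1, if_neg h2]
  · have h1 : ∀ v ∈ s.late u \ s.unserved, (if v ∈ I.nbhd u ∧ v ∈ s.unserved then
        I.residual s.assign v else if v ∈ s.late u ∧ v ∉ s.unserved then
        m / S * I.residual s.assign v else 0) = m / S * I.residual s.assign v := by
      intro v hv
      rw [Finset.mem_sdiff] at hv
      rw [if_neg fun h => hv.2 h.2, if_pos hv]
    rw [Finset.sum_congr rfl h1, ← Finset.mul_sum]
    change m / S * S = m
    -- For `S = 0` the quotient `m / S` is zero by convention, and `m` vanishes too.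
    by_cases h0 : S = 0
    · rw [h0, mul_zero]
      exact le_antisymm hm0 (h0 ▸ hmS)
    · exact div_mul_cancel₀ m h0

theorem PrimalInv.exists_greedyStep {I : CapDom V} {s : GreedyState V} (hs : I.PrimalInv s)
    (hne : s.unserved.Nonempty) : ∃ u t, I.GreedyStep s u t := by
  classical
  have hpos : (Finset.univ.filter fun u => 0 < I.pending s u).Nonempty := by
    obtain ⟨v, hv⟩ := hne
    refine ⟨v, ?_⟩
    rw [Finset.mem_filter]
    refine ⟨Finset.mem_univ v, ?_⟩
    refine ((I.d_nonneg v).lt_of_ne (hs.demand v hv).symm).trans_le ?_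
    exact Finset.single_le_sum (f := I.d) (fun x _ => I.d_nonneg x)
      (Finset.mem_inter.2 ⟨self_mem_nbhd v, hv⟩)
  obtain ⟨u, hu, hmin⟩ := Finset.exists_min_image _ (I.saturationTime s) hpos
  have hu' : 0 < I.pending s u := (Finset.mem_filter.1 hu).2
  have hfirst : ∀ v, 0 < I.pending s v → I.saturationTime s u ≤ I.saturationTime s v :=
    fun v hv => hmin v (Finset.mem_filter.2 ⟨Finset.mem_univ v, hv⟩)
  set U : Finset V := s.unserved.filter fun v => v ∉ I.nbhd u with hU
  -- Only the unserved set enters `pending`, so this provisional state gives the loads after the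
  -- step, on which the new `D^*` depends.
  set r : GreedyState V := { s with unserved := U } with hr
  set sl : V → ℝ :=
    fun v => s.slack v - I.saturationTime s u * min (I.c v) (I.pending s v)
  set la : V → Finset V := fun v => if I.c v < I.pending s v ∧ I.pending r v ≤ I.c v then
    I.nbhd v ∩ s.unserved else s.late v with hla
  have hlate : ∀ v, I.c v < I.pending s v → I.pending r v ≤ I.c v → ∀ x, x ∈ la v ↔
      x ∈ I.nbhd v ∧ (x ∈ U ∨ (x ∈ I.nbhd u ∧ x ∈ s.unserved)) := by
    intro v h1 h2 x
    simp only [hla, if_pos (And.intro h1 h2), Finset.mem_inter, hU, Finset.mem_filter]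
    tauto
  have hold : ∀ v, ¬ (I.c v < I.pending s v ∧ I.pending r v ≤ I.c v) → la v = s.late v :=
    fun v hv => if_neg hv
  have hUmem : ∀ v, v ∈ U ↔ v ∈ s.unserved ∧ v ∉ I.nbhd u := fun v => Finset.mem_filter
  rcases le_or_gt (I.pending s u) (I.c u) with hl | hl
  · obtain ⟨a, ha⟩ := hs.exists_isLightService hl
    refine ⟨u, ⟨U, sl, la, fun v z => if z = u then s.assign v z + a v else s.assign v z,
      insert u s.light, s.heavy⟩, hu', hfirst, fun _ => rfl, hUmem, hlate, hold,
      fun _ => ⟨rfl, fun v => Finset.mem_insert, a, ha, fun v => if_pos rfl,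
        fun v z hz => if_neg hz⟩, fun h => absurd h hl.not_gt⟩
  · exact ⟨u, ⟨U, sl, la, s.assign, s.light, s.heavy ++ [u]⟩, hu', hfirst, fun _ => rfl, hUmem,
      hlate, hold, fun h => absurd h hl.not_ge, fun _ => ⟨rfl, rfl, rfl⟩⟩

theorem GreedyStep.card_lt {I : CapDom V} {s t : GreedyState V} {u : V}
    (h : I.GreedyStep s u t) : t.unserved.card < s.unserved.card := by
  obtain ⟨v, hv, hvs⟩ := exists_unserved h.pending_pos
  refine Finset.card_lt_card ⟨h.unserved_subset, fun hc => ?_⟩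
  exact ((h.unserved v).1 (hc hvs)).2 hv

theorem exists_greedyRun (I : CapDom V) : ∃ s, I.GreedyRun s := by
  have key : ∀ n (s : GreedyState V), s.unserved.card ≤ n → I.PrimalInv s →
      ∃ t, Relation.ReflTransGen (fun s₁ s₂ => ∃ u, I.GreedyStep s₁ u s₂) s t ∧
        t.unserved = ∅ := by
    intro n
    induction n with
    | zero => exact fun s hs _ => ⟨s, .refl, Finset.card_eq_zero.1 (Nat.le_zero.1 hs)⟩
    | succ n ih =>
      intro s hn hs
      rcases s.unserved.eq_empty_or_nonempty with h0 | h0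
      · exact ⟨s, .refl, h0⟩
      · obtain ⟨u, t, ht⟩ := hs.exists_greedyStep h0
        obtain ⟨t', h1, h2⟩ := ih t (by have := ht.card_lt; omega) (ht.primalInv hs)
        exact ⟨t', .head ⟨u, ht⟩ h1, h2⟩
  exact key _ _ le_rfl (primalInv_init I)

/-! ### The dual solution built by the run -/

/-- Quantities recorded along a run for its analysis: the time, the dual variables `y`, the part
`room u v` of the demand of `v` that pays for `u` and for which there is room at `u`, the vertex
`server v` that removes `v` from `V^φ`, and the order in which the vertices are saturated. -/
structure RunRecord (V : Type*) where
  time : ℝ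
  y : V → ℝ
  room : V → V → ℝ
  server : V → V
  rank : V → ℕ
  count : ℕ

/-- The invariants of the main loop that concern the dual variables. -/
structure DualInv (I : CapDom V) (s : GreedyState V) (ρ : RunRecord V) : Prop where
  slack_nonneg : ∀ v, 0 ≤ s.slack v
  time_nonneg : 0 ≤ ρ.time
  y_nonneg : ∀ v, 0 ≤ ρ.y v
  y_unserved : ∀ v ∈ s.unserved, ρ.y v = ρ.time
  -- Dual feasibility with the multipliers of the local bounds eliminated: every LP column at `u` is
  -- tested directly.
  dual : ∀ u, ∀ (f : V → ℝ) (x : ℝ), (∀ v ∈ I.nbhd u, 0 ≤ f v) → (∀ v ∈ I.nbhd u, f v ≤ I.d v * x) →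
    ∑ v ∈ I.nbhd u, f v ≤ I.c u * x → ∑ v ∈ I.nbhd u, f v * ρ.y v ≤ (I.w u - s.slack u) * x
  paid_heavy : ∀ u, I.c u < I.pending s u → I.w u - s.slack u = I.c u * ρ.time
  room_nonneg : ∀ u v, 0 ≤ ρ.room u v
  room_le : ∀ u v, ρ.room u v ≤ I.d v
  paid_light : ∀ u, I.pending s u ≤ I.c u → I.w u - s.slack u = ∑ v ∈ I.nbhd u, ρ.room u v * ρ.y v
  room_unserved : ∀ u, I.pending s u ≤ I.c u → ∀ v ∈ I.nbhd u, v ∈ s.unserved → ρ.room u v = I.d v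
  room_sum : ∀ u, I.pending s u ≤ I.c u → ∑ v ∈ I.nbhd u, ρ.room u v ≤ I.c u
  saturated : ∀ u, IsSaturated s u → s.slack u = 0
  server_mem : ∀ v, I.d v ≠ 0 → v ∉ s.unserved → ρ.server v ∈ I.nbhd v
  server_saturated : ∀ v, I.d v ≠ 0 → v ∉ s.unserved → IsSaturated s (ρ.server v)
  server_light : ∀ v, I.d v ≠ 0 → v ∉ s.unserved → ρ.server v ∈ s.light →
    ρ.room (ρ.server v) v = I.d v
  server_heavy : ∀ v, I.d v ≠ 0 → v ∉ s.unserved → ρ.server v ∈ s.heavy →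
    I.w (ρ.server v) = I.c (ρ.server v) * ρ.y v
  -- A heavy vertex becomes lightly loaded in its own step, so only the vertices it serves pay for
  -- it.
  room_heavy : ∀ h ∈ s.heavy, ∀ v ∈ I.nbhd h, ρ.room h v ≠ 0 →
    v ∉ s.unserved ∧ ρ.server v = h
  serves : ∀ u, IsSaturated s u → ∃ v ∈ I.nbhd u, I.d v ≠ 0 ∧ v ∉ s.unserved ∧ ρ.server v = u
  rank_lt : ∀ u, IsSaturated s u → ρ.rank u < ρ.count
  -- The server of `v` is the first saturated vertex of `N[v]`.
  rank_server : ∀ v, I.d v ≠ 0 → v ∉ s.unserved → ∀ u ∈ I.nbhd v, IsSaturated s u →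
    u ≠ ρ.server v → ρ.rank (ρ.server v) < ρ.rank u

theorem dualInv_init (I : CapDom V) :
    I.DualInv I.greedyInit ⟨0, fun _ => 0, fun _ v => I.d v, id, fun _ => 0, 0⟩ where
  slack_nonneg := I.w_nonneg
  time_nonneg := le_rfl
  y_nonneg _ := le_rfl
  y_unserved _ _ := rfl
  dual := by simp [greedyInit]
  paid_heavy := by simp [greedyInit]
  room_nonneg _ := I.d_nonneg
  room_le _ _ := le_rfl
  paid_light := by simp [greedyInit]
  room_unserved _ _ _ _ _ := rfl
  room_sum u hu := by
    classical
    rw [pending_eq] at hu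
    refine le_of_eq_of_le (Finset.sum_congr rfl fun v _ => ?_) hu
    by_cases hd : I.d v = 0 <;> simp [greedyInit, hd]
  saturated := by simp [greedyInit, IsSaturated]
  server_mem := by simp +contextual [greedyInit]
  server_saturated := by simp +contextual [greedyInit]
  server_light := by simp [greedyInit]
  server_heavy := by simp [greedyInit]
  room_heavy := by simp [greedyInit]
  serves := by simp [greedyInit, IsSaturated]
  rank_lt := by simp [greedyInit, IsSaturated]
  rank_server := by simp [greedyInit, IsSaturated]

open scoped Classical in
/-- The record after the saturation of `u`. -/
def RunRecord.next (ρ : RunRecord V) (I : CapDom V) (s : GreedyState V) (u : V)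
    (t : GreedyState V) : RunRecord V where
  time := ρ.time + I.saturationTime s u
  y := fun v => if v ∈ s.unserved then ρ.y v + I.saturationTime s u else ρ.y v
  -- When `x` turns lightly loaded, unserved demand keeps its full share and the demand removed in
  -- this step is scaled so that the shares add up to `c x`.
  room := fun x v => if I.c x < I.pending s x ∧ I.pending t x ≤ I.c x then
      if v ∈ t.unserved then I.d v else if v ∈ s.unserved then
        (I.c x - I.pending t x) / (I.pending s x - I.pending t x) * I.d v else 0
    else ρ.room x v
  server := fun v => if v ∈ I.nbhd u ∧ v ∈ s.unserved then u else ρ.server v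
  rank := Function.update ρ.rank u ρ.count
  count := ρ.count + 1

theorem GreedyStep.dualInv {I : CapDom V} {s t : GreedyState V} {u : V} {ρ : RunRecord V}
    (h : I.GreedyStep s u t) (hp : I.PrimalInv s) (hs : I.DualInv s ρ) :
    I.DualInv t (ρ.next I s u t) := by
  classical
  set r := I.saturationTime s u with hrdef
  have hnot := h.not_saturated hp
  have hmin : 0 < min (I.c u) (I.pending s u) := lt_min (I.c_pos u) h.pending_pos
  have hr : 0 ≤ r := div_nonneg (hs.slack_nonneg u) hmin.le
  have hru : r * min (I.c u) (I.pending s u) = s.slack u := div_mul_cancel₀ _ hmin.ne'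
  have hmono : ∀ v, I.pending t v ≤ I.pending s v := pending_mono h.unserved_subset
  have hsum : ∀ x (f : V → ℝ), ∑ v ∈ I.nbhd x, f v * (ρ.next I s u t).y v =
      ∑ v ∈ I.nbhd x, f v * ρ.y v + r * ∑ v ∈ I.nbhd x, if v ∈ s.unserved then f v else 0 := by
    intro x f
    rw [Finset.mul_sum, ← Finset.sum_add_distrib]
    refine Finset.sum_congr rfl fun v _ => ?_
    simp only [RunRecord.next]
    split_ifs <;> ring
  have hpend0 : ∀ x, IsSaturated s x → I.pending s x = 0 := fun x hx =>
    pending_eq_zero (hp.saturated x hx)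
  have hroom : ∀ x, IsSaturated s x → (ρ.next I s u t).room x = ρ.room x := by
    intro x hx
    funext v
    refine if_neg fun hc => ?_
    rw [hpend0 x hx] at hc
    exact (I.c_pos x).not_gt hc.1
  have hpendu : I.pending t u = 0 := pending_eq_zero fun v hv hvt => ((h.unserved v).1 hvt).2 hv
  have hsat := h.saturated_iff
  have hnew : ∀ v, v ∉ t.unserved → v ∈ s.unserved → v ∈ I.nbhd u := fun v h1 h2 => by
    by_contra hc
    exact h1 ((h.unserved v).2 ⟨h2, hc⟩)
  have hserver : ∀ v, v ∉ t.unserved → (v ∈ I.nbhd u ∧ v ∈ s.unserved ∧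
      (ρ.next I s u t).server v = u) ∨ (v ∉ s.unserved ∧
      (ρ.next I s u t).server v = ρ.server v ∧ (ρ.next I s u t).y v = ρ.y v) := by
    intro v hv
    by_cases hvs : v ∈ s.unserved
    · exact Or.inl ⟨hnew v hv hvs, hvs, if_pos ⟨hnew v hv hvs, hvs⟩⟩
    · exact Or.inr ⟨hvs, if_neg fun hc => hvs hc.2, if_neg hvs⟩
  have hlq : ∀ x, I.c x < I.pending s x → I.pending t x ≤ I.c x →
      0 ≤ (I.c x - I.pending t x) / (I.pending s x - I.pending t x) ∧
      (I.c x - I.pending t x) / (I.pending s x - I.pending t x) ≤ 1 := by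
    intro x h1 h2
    have h3 : 0 < I.pending s x - I.pending t x := by linarith
    exact ⟨div_nonneg (by linarith) h3.le, (div_le_one h3).2 (by linarith)⟩
  have hturn : ∀ x, I.c x < I.pending s x → I.pending t x ≤ I.c x →
      ∑ v ∈ I.nbhd x, (ρ.next I s u t).room x v = I.c x := by
    intro x h1 h2
    have h3 : 0 < I.pending s x - I.pending t x := by linarith
    set q := (I.c x - I.pending t x) / (I.pending s x - I.pending t x) with hq
    have h4 : ∀ v ∈ I.nbhd x, (ρ.next I s u t).room x v =
        q * (if v ∈ s.unserved then I.d v else 0) +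
          (1 - q) * (if v ∈ t.unserved then I.d v else 0) := by
      intro v _
      have : v ∈ t.unserved → v ∈ s.unserved := fun hv => h.unserved_subset hv
      simp only [RunRecord.next, if_pos (And.intro h1 h2)]
      by_cases hvt : v ∈ t.unserved
      · simp only [hvt, this hvt, if_true]; ring
      · by_cases hvs : v ∈ s.unserved
        · simp only [hvt, hvs, if_true, if_false, hq]; ring
        · simp [hvt, hvs]
    rw [Finset.sum_congr rfl h4, Finset.sum_add_distrib, ← Finset.mul_sum, ← Finset.mul_sum,
      ← pending_eq, ← pending_eq]
    have h5 : q * (I.pending s x - I.pending t x) = I.c x - I.pending t x :=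
      div_mul_cancel₀ _ h3.ne'
    linarith
  have hslack : ∀ x, I.w x - t.slack x =
      I.w x - s.slack x + r * min (I.c x) (I.pending s x) := fun x => by
    rw [h.slack x]; ring
  have hslack0 : ∀ x, IsSaturated t x → t.slack x = 0 := by
    intro x hx
    rw [h.slack]
    rcases (hsat x).1 hx with rfl | hx
    · rw [hru, sub_self]
    · rw [hpend0 x hx, min_eq_right (I.c_pos x).le, mul_zero, hs.saturated x hx, sub_zero]
  refine ⟨fun v => ?_, add_nonneg hs.time_nonneg hr, fun v => ?_, fun v hv => ?_,
    fun x f z hf0 hfd hfc => ?_, fun x hx => ?_, fun x v => ?_, fun x v => ?_, fun x hx => ?_,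
    fun x hx v hv hvt => ?_, fun x hx => ?_, hslack0, fun v hd hv => ?_, fun v hd hv => ?_,
    fun v hd hv => ?_, fun v hd hv => ?_, fun z hz v hv hne => ?_, fun x hx => ?_, fun x hx => ?_,
    fun v hd hv x hxv hx hne => ?_⟩
  · rw [h.slack]
    rcases (I.pending_nonneg s v).eq_or_lt with h0 | h0
    · rw [← h0, min_eq_right (I.c_pos v).le, mul_zero, sub_zero]
      exact hs.slack_nonneg v
    · have h1 : 0 < min (I.c v) (I.pending s v) := lt_min (I.c_pos v) h0
      have h2 := h.first v h0
      rw [saturationTime, saturationTime, le_div_iff₀ h1] at h2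
      exact sub_nonneg.2 h2
  · simp only [RunRecord.next]
    split_ifs
    · exact add_nonneg (hs.y_nonneg v) hr
    · exact hs.y_nonneg v
  · simp only [RunRecord.next]
    rw [if_pos (h.unserved_subset hv), hs.y_unserved v (h.unserved_subset hv)]
  · rw [hsum, hslack, add_mul]
    refine add_le_add (hs.dual x f z hf0 hfd hfc) ?_
    rw [mul_assoc]
    refine mul_le_mul_of_nonneg_left ?_ hr
    -- The column gains `r` times its unserved part. This part is at most `c x * z` by capacity and
    -- at most `pending * z` by the local bounds, hence at most `z` times the rate of payment.
    have h1 : (∑ v ∈ I.nbhd x, if v ∈ s.unserved then f v else 0) ≤ I.c x * z := by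
      refine (Finset.sum_le_sum fun v hv => ?_).trans hfc
      split_ifs
      · exact le_rfl
      · exact hf0 v hv
    have h2 : (∑ v ∈ I.nbhd x, if v ∈ s.unserved then f v else 0) ≤ I.pending s x * z := by
      rw [pending_eq, Finset.sum_mul]
      refine Finset.sum_le_sum fun v hv => ?_
      split_ifs
      · exact hfd v hv
      · simp
    rcases min_choice (I.c x) (I.pending s x) with h3 | h3 <;> rw [h3] <;> assumption
  · have hx' := hx.trans_le (hmono x)
    rw [hslack, hs.paid_heavy x hx', min_eq_left hx'.le]
    simp only [RunRecord.next]
    ring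
  · simp only [RunRecord.next]
    split_ifs with h1 h2 h3
    · exact I.d_nonneg v
    · exact mul_nonneg (hlq x h1.1 h1.2).1 (I.d_nonneg v)
    · exact le_rfl
    · exact hs.room_nonneg x v
  · simp only [RunRecord.next]
    split_ifs with h1 h2 h3
    · exact le_rfl
    · exact mul_le_of_le_one_left (I.d_nonneg v) (hlq x h1.1 h1.2).2
    · exact I.d_nonneg v
    · exact hs.room_le x v
  · rcases le_or_gt (I.pending s x) (I.c x) with h1 | h1
    · have h2 : (ρ.next I s u t).room x = ρ.room x := by
        funext v
        exact if_neg fun hc => h1.not_gt hc.1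
      rw [hslack, hsum, h2, ← hs.paid_light x h1, min_eq_right h1]
      congr 2
      rw [pending_eq]
      refine Finset.sum_congr rfl fun v hv => ?_
      split_ifs with h3
      · exact (hs.room_unserved x h1 v hv h3).symm
      · rfl
    · have h2 : ∀ v ∈ I.nbhd x, (ρ.next I s u t).room x v * (ρ.next I s u t).y v =
          (ρ.next I s u t).room x v * (ρ.time + r) := by
        intro v _
        by_cases hvs : v ∈ s.unserved
        · congr 1
          simp only [RunRecord.next]
          rw [if_pos hvs, hs.y_unserved v hvs]
        · have : (ρ.next I s u t).room x v = 0 := by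
            simp only [RunRecord.next]
            rw [if_pos ⟨h1, hx⟩, if_neg fun hc => hvs (h.unserved_subset hc), if_neg hvs]
          rw [this, zero_mul, zero_mul]
      rw [Finset.sum_congr rfl h2, ← Finset.sum_mul, hturn x h1 hx, hslack, hs.paid_heavy x h1,
        min_eq_left h1.le]
      ring
  · simp only [RunRecord.next]
    split_ifs with h1
    · rfl
    · refine hs.room_unserved x ?_ v hv (h.unserved_subset hvt)
      by_contra! hc
      exact h1 ⟨hc, hx⟩
  · rcases le_or_gt (I.pending s x) (I.c x) with h1 | h1
    · have h2 : (ρ.next I s u t).room x = ρ.room x := by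
        funext v
        exact if_neg fun hc => h1.not_gt hc.1
      rw [h2]
      exact hs.room_sum x h1
    · exact (hturn x h1 hx).le
  · rcases hserver v hv with ⟨h1, h2, h3⟩ | ⟨h1, h3, -⟩ <;> rw [h3]
    · exact mem_nbhd_comm.1 h1
    · exact hs.server_mem v hd h1
  · rcases hserver v hv with ⟨h1, h2, h3⟩ | ⟨h1, h3, -⟩ <;> rw [h3, hsat]
    · exact Or.inl rfl
    · exact Or.inr (hs.server_saturated v hd h1)
  · rcases hserver v hv with ⟨h1, h2, h3⟩ | ⟨h1, h3, -⟩ <;> rw [h3] <;> intro hl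
    · have h4 : I.pending s u ≤ I.c u := by
        by_contra! hc
        rw [(h.heavy_case hc).2.1] at hl
        exact hnot (Or.inl hl)
      have : (ρ.next I s u t).room u v = ρ.room u v := if_neg fun hc => h4.not_gt hc.1
      rw [this]
      exact hs.room_unserved u h4 v h1 h2
    · have h5 := hs.server_saturated v hd h1
      have hne : ρ.server v ≠ u := fun hc => hnot (hc ▸ h5)
      rw [hroom _ h5]
      refine hs.server_light v hd h1 ?_
      rcases le_or_gt (I.pending s u) (I.c u) with h6 | h6
      · exact (((h.light_case h6).2.1 _).1 hl).resolve_left hne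
      · rwa [(h.heavy_case h6).2.1] at hl
  · rcases hserver v hv with ⟨h1, h2, h3⟩ | ⟨h1, h3, h4⟩ <;> rw [h3] <;> intro hl
    · have h4 : I.c u < I.pending s u := by
        by_contra! hc
        rw [(h.light_case hc).1] at hl
        exact hnot (Or.inr hl)
      have h5 := hslack u
      rw [hslack0 u ((hsat u).2 (Or.inl rfl)), hs.paid_heavy u h4, min_eq_left h4.le] at h5
      simp only [RunRecord.next]
      rw [if_pos h2, hs.y_unserved v h2, ← hrdef]
      linarith
    · rw [h4]
      refine hs.server_heavy v hd h1 ?_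
      have h5 := hs.server_saturated v hd h1
      have hne : ρ.server v ≠ u := fun hc => hnot (hc ▸ h5)
      rcases le_or_gt (I.pending s u) (I.c u) with h6 | h6
      · rwa [(h.light_case h6).1] at hl
      · rw [(h.heavy_case h6).1, List.mem_append, List.mem_singleton] at hl
        exact hl.resolve_right hne
  · by_cases hzs : IsSaturated s z
    · rw [hroom z hzs] at hne
      have hzh : z ∈ s.heavy := by
        rcases le_or_gt (I.pending s u) (I.c u) with h6 | h6
        · rwa [(h.light_case h6).1] at hz
        · rw [(h.heavy_case h6).1, List.mem_append, List.mem_singleton] at hz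
          exact hz.resolve_right fun hc => hnot (hc ▸ hzs)
      obtain ⟨h1, h2⟩ := hs.room_heavy z hzh v hv hne
      exact ⟨fun hc => h1 (h.unserved_subset hc), by
        rw [← h2]; exact if_neg fun hc => h1 hc.2⟩
    · have hzu : z = u := ((hsat z).1 (Or.inr hz)).resolve_right hzs
      subst hzu
      have h4 : I.c z < I.pending s z := by
        by_contra! hc
        rw [(h.light_case hc).1] at hz
        exact hzs (Or.inr hz)
      have hvt : v ∉ t.unserved := fun hc => ((h.unserved v).1 hc).2 hv
      have hvs : v ∈ s.unserved := by
        by_contra hc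
        refine hne ?_
        simp only [RunRecord.next]
        rw [if_pos ⟨h4, hpendu.trans_le (I.c_pos z).le⟩, if_neg hvt, if_neg hc]
      exact ⟨hvt, if_pos ⟨hv, hvs⟩⟩
  · rcases (hsat x).1 hx with rfl | hx
    · obtain ⟨v, hv, hvs⟩ := exists_unserved h.pending_pos
      exact ⟨v, hv, hp.demand v hvs, fun hc => ((h.unserved v).1 hc).2 hv, if_pos ⟨hv, hvs⟩⟩
    · obtain ⟨v, hv, hd, hvs, hvx⟩ := hs.serves x hx
      exact ⟨v, hv, hd, fun hc => hvs (h.unserved_subset hc), by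
        rw [← hvx]; exact if_neg fun hc => hvs hc.2⟩
  · simp only [RunRecord.next]
    by_cases hxu : x = u
    · rw [hxu, Function.update_self]
      exact Nat.lt_succ_self _
    · rw [Function.update_of_ne hxu]
      exact (hs.rank_lt x (((hsat x).1 hx).resolve_left hxu)).trans (Nat.lt_succ_self _)
  · rcases hserver v hv with ⟨h1, h2, h3⟩ | ⟨h1, h3, -⟩ <;> rw [h3] at hne ⊢
    · have h4 : IsSaturated s x := ((hsat x).1 hx).resolve_left hne
      exact absurd h2 (hp.saturated x h4 v (mem_nbhd_comm.1 hxv))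
    · have h5 := hs.server_saturated v hd h1
      have hne' : ρ.server v ≠ u := fun hc => hnot (hc ▸ h5)
      simp only [RunRecord.next]
      rw [Function.update_of_ne hne']
      by_cases hxu : x = u
      · rw [hxu, Function.update_self]
        exact hs.rank_lt _ h5
      · rw [Function.update_of_ne hxu]
        exact hs.rank_server v hd h1 x hxv (((hsat x).1 hx).resolve_left hxu) hne

theorem GreedyRun.invariants {I : CapDom V} {s : GreedyState V} (h : I.GreedyRun s) :
    I.PrimalInv s ∧ ∃ ρ, I.DualInv s ρ := by
  obtain ⟨h, -⟩ := h
  induction h with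
  | refl => exact ⟨primalInv_init I, _, dualInv_init I⟩
  | tail _ hst ih =>
    obtain ⟨u, hu⟩ := hst
    obtain ⟨hp, ρ, hd⟩ := ih
    exact ⟨hu.primalInv hp, _, hu.dualInv hp hd⟩

/-! ### Sparse neighbourhoods and the number of saturated vertices in them -/

/-- The only demand that can be assigned to `z` is that of `v`. -/
def IsPrivate (I : CapDom V) (z v : V) : Prop := ∀ x ∈ I.nbhd z, I.d x ≠ 0 → x = v

/-- The sparsity of the closed neighbourhoods on which the approximation factor depends. -/
def IsSparse (I : CapDom V) : Prop :=
  ∀ v, I.d v ≠ 0 → (I.nbhd v).card ≤ 7 ∧ ((I.nbhd v).card ≤ 6 ∨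
    (∃ z ∈ I.nbhd v, I.IsPrivate z v) ∨
    ∃ q ∈ I.nbhd v, ∃ r ∈ I.nbhd v, q ≠ v ∧ r ≠ v ∧ q ≠ r ∧
      (∀ x ∈ I.nbhd q, I.d x ≠ 0 → x ∈ I.nbhd v) ∧ (∀ x ∈ I.nbhd r, I.d x ≠ 0 → x ∈ I.nbhd v) ∧
      ∀ x ∈ I.nbhd v, I.d x ≠ 0 → x ∈ I.nbhd q ∨ x ∈ I.nbhd r)

/-- A vertex served by `q` also lies in `N[v]`, and its server is the first of its closed neighbours
to be saturated. -/
theorem DualInv.rank_lt_of_subset {I : CapDom V} {s : GreedyState V} {ρ : RunRecord V}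
    (hs : I.DualInv s ρ) {q v : V} (hq : IsSaturated s q) (hv : IsSaturated s v) (hqv : q ≠ v)
    (h : ∀ x ∈ I.nbhd q, I.d x ≠ 0 → x ∈ I.nbhd v) : ρ.rank q < ρ.rank v := by
  obtain ⟨x, hx, hd, hxs, hxq⟩ := hs.serves q hq
  have := hs.rank_server x hd hxs v (mem_nbhd_comm.1 (h x hx hd)) hv (by rw [hxq]; exact hqv.symm)
  rwa [hxq] at this

-- If all seven closed neighbours are saturated, a private `z` among them serves some vertex, which
-- can only be `v`. With `q` and `r` instead, both are saturated before `v`; but a vertex served by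
-- `v` lies in `N[q]` or `N[r]`, so one of the two comes after `v`.
open scoped Classical in
theorem DualInv.card_saturated_le {I : CapDom V} {s : GreedyState V} {ρ : RunRecord V}
    (hs : I.DualInv s ρ) (hI : I.IsSparse) {v : V} (hd : I.d v ≠ 0) :
    ((I.nbhd v).filter (IsSaturated s)).card ≤ 7 ∧
      (((I.nbhd v).filter (IsSaturated s)).card ≤ 6 ∨ I.IsPrivate (ρ.server v) v) := by
  have hle := Finset.card_filter_le (I.nbhd v) (IsSaturated s)
  obtain ⟨h7, h⟩ := hI v hd
  have hlt : ∀ u ∈ I.nbhd v, ¬ IsSaturated s u →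
      ((I.nbhd v).filter (IsSaturated s)).card ≤ 6 := fun u hu hus => by
    have : ((I.nbhd v).filter (IsSaturated s)).card < (I.nbhd v).card :=
      Finset.card_lt_card (Finset.filter_ssubset.2 ⟨u, hu, hus⟩)
    omega
  refine ⟨hle.trans h7, ?_⟩
  rcases h with h6 | ⟨z, hz, hzp⟩ | ⟨q, hq, r, hr, hqv, hrv, hqr, h1, h2, h3⟩
  · exact Or.inl (hle.trans h6)
  · by_cases hzs : IsSaturated s z
    · obtain ⟨x, hx, hxd, -, hxz⟩ := hs.serves z hzs
      obtain rfl := hzp x hx hxd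
      exact Or.inr (hxz ▸ hzp)
    · exact Or.inl (hlt z hz hzs)
  · left
    by_cases hqs : IsSaturated s q
    · by_cases hrs : IsSaturated s r
      · refine hlt v (self_mem_nbhd v) fun hvs => ?_
        obtain ⟨x, hx, hxd, hxs, hxv⟩ := hs.serves v hvs
        rcases h3 x hx hxd with h4 | h4
        · have h5 := hs.rank_server x hxd hxs q (mem_nbhd_comm.1 h4) hqs (by rwa [hxv])
          rw [hxv] at h5
          exact h5.not_gt (hs.rank_lt_of_subset hqs hvs hqv h1)
        · have h5 := hs.rank_server x hxd hxs r (mem_nbhd_comm.1 h4) hrs (by rwa [hxv])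
          rw [hxv] at h5
          exact h5.not_gt (hs.rank_lt_of_subset hrs hvs hrv h2)
      · exact hlt r hr hrs
    · exact hlt q hq hqs

/-! ### Weak duality for the linear relaxation -/

theorem sum_nbhd_comm (I : CapDom V) (F : V → V → ℝ) :
    ∑ v, ∑ u ∈ I.nbhd v, F v u = ∑ u, ∑ v ∈ I.nbhd u, F v u :=
  Finset.sum_comm' fun v u => by simpa using mem_nbhd_comm

/-- Needed because a real infimum over the empty set would be zero. Every vertex serves itself; the
maximum with `1` is for the local bounds. -/
theorem exists_isFractional (I : CapDom V) : ∃ f x, I.IsFractional f x := by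
  classical
  refine ⟨fun v u => if v = u then I.d v else 0, fun v => max 1 (I.d v / I.c v), ?_, ?_, ?_, ?_, ?_⟩
  · intro u
    simp [Finset.sum_ite_eq, self_mem_nbhd]
  · intro u
    rw [Finset.sum_ite_eq' (I.nbhd u) u, if_pos (self_mem_nbhd u), sub_nonneg]
    calc I.d u = I.c u * (I.d u / I.c u) := by field_simp [(I.c_pos u).ne']
      _ ≤ _ := mul_le_mul_of_nonneg_left (le_max_right _ _) (I.c_pos u).le
  · intro u v _
    rw [sub_nonneg]
    have h1 : I.d v ≤ I.d v * max 1 (I.d u / I.c u) :=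
      le_mul_of_one_le_right (I.d_nonneg v) (le_max_left _ _)
    split_ifs
    · exact h1
    · exact (I.d_nonneg v).trans h1
  · intro u v
    split_ifs
    · exact I.d_nonneg u
    · exact le_rfl
  · exact fun u => zero_le_one.trans (le_max_left _ _)

/-- Weak duality. -/
theorem DualInv.sum_le_optFractional {I : CapDom V} {s : GreedyState V} {ρ : RunRecord V}
    (hs : I.DualInv s ρ) : ∑ v, I.d v * ρ.y v ≤ I.optFractional := by
  refine le_csInf ?_ ?_
  · obtain ⟨f, x, h⟩ := I.exists_isFractional
    exact ⟨_, f, x, h, rfl⟩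
  · rintro _ ⟨f, x, h, rfl⟩
    calc ∑ v, I.d v * ρ.y v ≤ ∑ v, ∑ u ∈ I.nbhd v, f v u * ρ.y v := by
          refine Finset.sum_le_sum fun v _ => ?_
          rw [← Finset.sum_mul]
          exact mul_le_mul_of_nonneg_right (sub_nonneg.1 (h.covers v)) (hs.y_nonneg v)
      _ = ∑ u, ∑ v ∈ I.nbhd u, f v u * ρ.y v := sum_nbhd_comm I _
      _ ≤ ∑ u, I.w u * x u := by
          refine Finset.sum_le_sum fun u _ => ?_
          refine (hs.dual u (fun v => f v u) (x u) (fun v _ => h.f_nonneg v u)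
            (fun v hv => sub_nonneg.1 (h.local_bound u v hv)) (sub_nonneg.1 (h.capacity u))).trans ?_
          have := hs.slack_nonneg u
          exact mul_le_mul_of_nonneg_right (by linarith) (h.x_nonneg u)

/-! ### The redistributed assignment and its charging scheme -/

theorem multiplicity_eq_zero {I : CapDom V} {f : V → V → ℝ} {u : V}
    (h : ∀ v ∈ I.nbhd u, f v u = 0) : I.multiplicity f u = 0 := by
  unfold multiplicity
  rw [Finset.sum_eq_zero h, zero_div, Nat.ceil_zero]

theorem exists_admissible_le_six {I : CapDom V} {s : GreedyState V} {ρ : RunRecord V}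
    (hI : I.IsSparse) (hp : I.PrimalInv s) (hs : I.DualInv s ρ) (hfin : s.unserved = ∅) :
    ∃ g, I.IsAdmissible s g ∧ I.cost g ≤ 6 * I.optFractional := by
  classical
  have hun : ∀ v, v ∉ s.unserved := by simp [hfin]
  have hpend : ∀ u, I.pending s u ≤ I.c u := fun u => by
    rw [pending_eq_zero fun v _ => hun v]
    exact (I.c_pos u).le
  -- `F v` singles out the vertices whose server is excluded from the shares and receives only the
  -- overflow `ov v`. A private server is treated this way even if it is light, so that it can stay
  -- unused.
  set F : V → Prop := fun v => ρ.server v ∈ s.heavy ∨ I.IsPrivate (ρ.server v) v with hF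
  set L : V → Finset V := fun v =>
    (I.nbhd v).filter fun u => u ∈ s.light ∧ ¬ (F v ∧ u = ρ.server v) with hL
  have hLmem : ∀ v u, u ∈ L v ↔ u ∈ I.nbhd v ∧ u ∈ s.light ∧ ¬ (F v ∧ u = ρ.server v) :=
    fun v u => Finset.mem_filter
  set A : V → ℝ := fun v => ∑ u ∈ L v, ρ.room u v with hA
  have hA0 : ∀ v, 0 ≤ A v := fun v => Finset.sum_nonneg fun u _ => hs.room_nonneg u v
  set ov : V → ℝ := fun v => I.d v - min (I.d v) (A v) with hov
  have hov0 : ∀ v, 0 ≤ ov v := fun v => sub_nonneg.2 (min_le_left _ _)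
  have hovd : ∀ v, ov v ≤ I.d v := fun v => sub_le_self _ (le_min (I.d_nonneg v) (hA0 v))
  have hroomd : ∀ u v, I.d v = 0 → ρ.room u v = 0 := fun u v hd =>
    le_antisymm (hd ▸ hs.room_le u v) (hs.room_nonneg u v)
  have hov_d : ∀ v, I.d v = 0 → ov v = 0 := fun v hd => le_antisymm (hd ▸ hovd v) (hov0 v)
  -- The shares of `v` are filled in the common proportion `θ`.
  have hθ : ∀ v, ∃ θ : ℝ, 0 ≤ θ ∧ θ ≤ 1 ∧ A v * θ = min (I.d v) (A v) := fun v => by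
    have h1 : 0 ≤ min (I.d v) (A v) := le_min (I.d_nonneg v) (hA0 v)
    rcases (hA0 v).eq_or_lt with h0 | h0
    · exact ⟨0, le_rfl, zero_le_one, by rw [← h0, min_eq_right (I.d_nonneg v), zero_mul]⟩
    · exact ⟨min (I.d v) (A v) / A v, div_nonneg h1 h0.le, (div_le_one h0).2 (min_le_right _ _),
        mul_div_cancel₀ _ h0.ne'⟩
  choose θ hθ0 hθ1 hθA using hθ
  have hbsat : ∀ v, I.d v ≠ 0 → ρ.server v ∈ s.light ∨ ρ.server v ∈ s.heavy :=
    fun v hd => hs.server_saturated v hd (hun v)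
  have hbmem : ∀ v, I.d v ≠ 0 → ρ.server v ∈ I.nbhd v := fun v hd => hs.server_mem v hd (hun v)
  -- Outside `F` the server is light, belongs to `L v` and has room for all of `d v`.
  have hovF : ∀ v, ¬ F v → ov v = 0 := by
    intro v hv
    by_cases hd : I.d v = 0
    · exact hov_d v hd
    have hl : ρ.server v ∈ s.light := (hbsat v hd).resolve_right fun h => hv (Or.inl h)
    have hm : ρ.server v ∈ L v := (hLmem _ _).2 ⟨hbmem v hd, hl, fun h => hv h.1⟩
    have h1 : I.d v ≤ A v := by
      rw [← hs.server_light v hd (hun v) hl]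
      exact Finset.single_le_sum (f := fun u => ρ.room u v) (fun u _ => hs.room_nonneg u v) hm
    change I.d v - min (I.d v) (A v) = 0
    rw [min_eq_left h1, sub_self]
  set g : V → V → ℝ := fun v u =>
    (if u ∈ L v then ρ.room u v * θ v else 0) + (if u = ρ.server v then ov v else 0) with hg
  have hg0 : ∀ v u, 0 ≤ g v u := fun v u => by
    refine add_nonneg ?_ ?_ <;> split_ifs
    · exact mul_nonneg (hs.room_nonneg u v) (hθ0 v)
    · exact le_rfl
    · exact hov0 v
    · exact le_rfl
  have hgd : ∀ v u, I.d v = 0 → g v u = 0 := fun v u hd => by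
    simp [hg, hroomd u v hd, hov_d v hd]
  have hgsupp : ∀ v u, g v u ≠ 0 → u ∈ s.light ∨ u ∈ s.heavy := by
    intro v u hne
    by_contra hc
    have hd : I.d v ≠ 0 := fun hd => hne (hgd v u hd)
    refine hne ?_
    have h1 : u ∉ L v := fun h => hc (Or.inl ((hLmem v u).1 h).2.1)
    have h2 : u ≠ ρ.server v := fun h => hc (h ▸ hbsat v hd)
    simp [hg, h1, h2]
  have hgle : ∀ u ∈ s.light, ∀ v, g v u ≤ ρ.room u v := by
    intro u hu v
    by_cases hd : I.d v = 0
    · rw [hgd v u hd]; exact hs.room_nonneg u v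
    have h1 : ρ.room u v * θ v ≤ ρ.room u v := mul_le_of_le_one_right (hs.room_nonneg u v) (hθ1 v)
    by_cases hub : u = ρ.server v
    · by_cases hFv : F v
      · have : u ∉ L v := fun h => ((hLmem v u).1 h).2.2 ⟨hFv, hub⟩
        simp only [hg, if_neg this, if_pos hub, zero_add]
        rw [hub] at hu ⊢
        rw [hs.server_light v hd (hun v) hu]
        exact hovd v
      · simp only [hg, hovF v hFv, ite_self, add_zero]
        split_ifs
        · exact h1
        · exact hs.room_nonneg u v
    · simp only [hg, if_neg hub, add_zero]
      split_ifs
      · exact h1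
      · exact hs.room_nonneg u v
  have hglight : ∀ u ∈ s.light, I.multiplicity g u ≤ 1 := fun u hu =>
    multiplicity_le_one ((Finset.sum_le_sum fun v _ => hgle u hu v).trans
      (hs.room_sum u (hpend u)))
  have hadm : I.IsAdmissible s g := by
    refine ⟨⟨hg0, fun v => ?_⟩, hgsupp, hglight⟩
    by_cases hd : I.d v = 0
    · rw [hd]; exact Finset.sum_nonneg fun u _ => hg0 v u
    have h1 : ∑ u ∈ I.nbhd v, (if u ∈ L v then ρ.room u v * θ v else 0) = A v * θ v := by
      rw [← Finset.sum_filter, Finset.sum_mul]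
      refine Finset.sum_congr ?_ fun _ _ => rfl
      ext u
      rw [Finset.mem_filter, hLmem]
      tauto
    have h2 : ∑ u ∈ I.nbhd v, (if u = ρ.server v then ov v else 0) = ov v := by
      rw [Finset.sum_ite_eq' (I.nbhd v) (ρ.server v), if_pos (hbmem v hd)]
    rw [Finset.sum_add_distrib, h1, h2, hθA]
    simp [hov]
  -- The payment of `v` to its server under `F`: the overflow at price `y v`, and `d v * y v`
  -- towards one copy, which is waived if the server is private and nothing overflows.
  set fb : V → ℝ := fun v =>
    ov v * ρ.y v + (if I.IsPrivate (ρ.server v) v ∧ ov v = 0 then 0 else I.d v * ρ.y v) with hfb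
  have hdy : ∀ v, 0 ≤ I.d v * ρ.y v := fun v => mul_nonneg (I.d_nonneg v) (hs.y_nonneg v)
  have hovy : ∀ v, 0 ≤ ov v * ρ.y v := fun v => mul_nonneg (hov0 v) (hs.y_nonneg v)
  have hfb0 : ∀ v, 0 ≤ fb v := fun v => by
    refine add_nonneg (hovy v) ?_
    split_ifs
    · exact le_rfl
    · exact hdy v
  have hpaid : ∀ u, IsSaturated s u → I.w u = ∑ v ∈ I.nbhd u, ρ.room u v * ρ.y v := fun u hu => by
    rw [← hs.paid_light u (hpend u), hs.saturated u hu, sub_zero]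
  have hcharge : ∀ u, I.w u * I.multiplicity g u ≤
      ∑ v, (if u ∈ L v then ρ.room u v * ρ.y v else 0) +
        ∑ v, (if ρ.server v = u ∧ F v then fb v else 0) := by
    intro u
    have hry : ∀ v, 0 ≤ ρ.room u v * ρ.y v := fun v =>
      mul_nonneg (hs.room_nonneg u v) (hs.y_nonneg v)
    have hn1 : 0 ≤ ∑ v, (if u ∈ L v then ρ.room u v * ρ.y v else 0) :=
      Finset.sum_nonneg fun v _ => by
        split_ifs
        · exact hry v
        · exact le_rfl
    have hn2' : ∀ v, 0 ≤ (if ρ.server v = u ∧ F v then fb v else 0) := fun v => by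
        split_ifs
        · exact hfb0 v
        · exact le_rfl
    have hn2 : 0 ≤ ∑ v, (if ρ.server v = u ∧ F v then fb v else 0) :=
      Finset.sum_nonneg fun v _ => hn2' v
    have hzero : I.multiplicity g u = 0 → I.w u * I.multiplicity g u ≤
      ∑ v, (if u ∈ L v then ρ.room u v * ρ.y v else 0) +
        ∑ v, (if ρ.server v = u ∧ F v then fb v else 0) := fun h0 => by
      rw [h0, Nat.cast_zero, mul_zero]
      exact add_nonneg hn1 hn2
    have hpriv : ∀ v, ρ.server v = u → F v → I.IsPrivate u v → ov v = 0 →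
        I.multiplicity g u = 0 := fun v hv hFv hpv h0 =>
      multiplicity_eq_zero fun x hx => by
        by_cases hd : I.d x = 0
        · exact hgd x u hd
        · obtain rfl := hpv x hx hd
          have : u ∉ L x := fun h => ((hLmem x u).1 h).2.2 ⟨hFv, hv.symm⟩
          simp [hg, this, h0]
    by_cases hl : u ∈ s.light
    · have h1 : I.w u * I.multiplicity g u ≤ I.w u :=
        mul_le_of_le_one_right (I.w_nonneg u) (by exact_mod_cast hglight u hl)
      -- A light server of some `v` in `F` is private to `v`; it is unused without overflow, and
      -- otherwise its single copy costs at most `d v * y v`. Any other light vertex is paid for by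
      -- its shares.
      by_cases hex : ∃ v, I.d v ≠ 0 ∧ ρ.server v = u ∧ F v
      · obtain ⟨v, hd, hvu, hFv⟩ := hex
        have hpv : I.IsPrivate u v := by
          rcases id hFv with h | h
          · exact absurd (hvu ▸ h) (hp.disjoint u hl)
          · exact hvu ▸ h
        by_cases h0 : ov v = 0
        · exact hzero (hpriv v hvu hFv hpv h0)
        · have h2 : I.w u ≤ I.d v * ρ.y v := by
            rw [hpaid u (Or.inl hl), Finset.sum_eq_single v]
            · exact mul_le_mul_of_nonneg_right (hs.room_le u v) (hs.y_nonneg v)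
            · intro x hx hxv
              rw [hroomd u x (by by_contra hxd; exact hxv (hpv x hx hxd)), zero_mul]
            · exact fun hn => absurd (mem_nbhd_comm.1 (hvu ▸ hbmem v hd)) hn
          have h3 : fb v ≤ ∑ v, (if ρ.server v = u ∧ F v then fb v else 0) := by
            have := Finset.single_le_sum (f := fun v => if ρ.server v = u ∧ F v then fb v else 0)
              (fun x _ => hn2' x) (Finset.mem_univ v)
            simpa only [if_pos (And.intro hvu hFv)] using this
          have h4 : I.d v * ρ.y v ≤ fb v := by
            simp only [hfb, h0, and_false, if_false]
            linarith [hovy v]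
          linarith
      · have h2 : I.w u ≤ ∑ v, (if u ∈ L v then ρ.room u v * ρ.y v else 0) := by
          rw [hpaid u (Or.inl hl)]
          calc ∑ v ∈ I.nbhd u, ρ.room u v * ρ.y v
              ≤ ∑ v ∈ I.nbhd u, (if u ∈ L v then ρ.room u v * ρ.y v else 0) := by
                refine Finset.sum_le_sum fun v hv => ?_
                split_ifs with h
                · exact le_rfl
                · by_cases hd : I.d v = 0
                  · rw [hroomd u v hd, zero_mul]
                  · exact absurd ((hLmem v u).2 ⟨mem_nbhd_comm.1 hv, hl,
                      fun hc => hex ⟨v, hd, hc.2.symm, hc.1⟩⟩) h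
            _ ≤ _ := Finset.sum_le_sum_of_subset_of_nonneg (Finset.subset_univ _) fun v _ _ => by
                split_ifs
                · exact hry v
                · exact le_rfl
        linarith
    by_cases hh : u ∈ s.heavy
    · by_cases hex : ∃ v, ρ.server v = u ∧ I.IsPrivate u v ∧ ov v = 0
      · obtain ⟨v, hvu, hpv, h0⟩ := hex
        exact hzero (hpriv v hvu (Or.inl (hvu ▸ hh)) hpv h0)
      have h1 : ∀ v, g v u = if ρ.server v = u then ov v else 0 := fun v => by
        have : u ∉ L v := fun h => hl ((hLmem v u).1 h).2.1
        simp [hg, this, eq_comm]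
      -- Rounding up adds at most one copy. As `w u = c u * y v` for each `v` served by `u`, the
      -- fractional load costs exactly the overflow at price `y v`; the additional copy is paid by
      -- the vertices that `u` serves.
      have h2 : (I.multiplicity g u : ℝ) ≤ (∑ v ∈ I.nbhd u, g v u) / I.c u + 1 :=
        (Nat.ceil_lt_add_one (div_nonneg (Finset.sum_nonneg fun v _ => hg0 v u)
          (I.c_pos u).le)).le
      have h3 : I.w u * ((∑ v ∈ I.nbhd u, g v u) / I.c u) =
          ∑ v ∈ I.nbhd u, if ρ.server v = u then ov v * ρ.y v else 0 := by
        rw [Finset.sum_div, Finset.mul_sum]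
        refine Finset.sum_congr rfl fun v hv => ?_
        rw [h1]
        split_ifs with h
        · by_cases hd : I.d v = 0
          · simp [hov_d v hd]
          · have h4 := hs.server_heavy v hd (hun v) (h ▸ hh)
            rw [h] at h4
            have h5 := (I.c_pos u).ne'
            rw [h4]
            field_simp
        · simp
      have h4 : I.w u ≤ ∑ v ∈ I.nbhd u, if ρ.server v = u then I.d v * ρ.y v else 0 := by
        rw [hpaid u (Or.inr hh)]
        refine Finset.sum_le_sum fun v hv => ?_
        split_ifs with h
        · exact mul_le_mul_of_nonneg_right (hs.room_le u v) (hs.y_nonneg v)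
        · have : ρ.room u v = 0 := by
            by_contra hc
            exact h (hs.room_heavy u hh v hv hc).2
          rw [this, zero_mul]
      have h5 : (∑ v ∈ I.nbhd u, if ρ.server v = u then ov v * ρ.y v else 0) +
          (∑ v ∈ I.nbhd u, if ρ.server v = u then I.d v * ρ.y v else 0) ≤
          ∑ v, (if ρ.server v = u ∧ F v then fb v else 0) := by
        rw [← Finset.sum_add_distrib]
        refine (Finset.sum_le_sum fun v _ => ?_).trans
          (Finset.sum_le_sum_of_subset_of_nonneg (Finset.subset_univ _) fun v _ _ => hn2' v)
        by_cases h : ρ.server v = u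
        · have hFv : F v := Or.inl (h ▸ hh)
          have hn : ¬ (I.IsPrivate (ρ.server v) v ∧ ov v = 0) := fun hc =>
            hex ⟨v, h, h ▸ hc.1, hc.2⟩
          rw [if_pos h, if_pos h, if_pos ⟨h, hFv⟩]
          simp only [hfb, if_neg hn]
          exact le_rfl
        · rw [if_neg h, if_neg h, add_zero]
          exact hn2' v
      calc I.w u * I.multiplicity g u
          ≤ I.w u * ((∑ v ∈ I.nbhd u, g v u) / I.c u + 1) :=
            mul_le_mul_of_nonneg_left h2 (I.w_nonneg u)
        _ = I.w u * ((∑ v ∈ I.nbhd u, g v u) / I.c u) + I.w u := by ring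
        _ ≤ _ := by rw [h3]; linarith
    · refine hzero (multiplicity_eq_zero fun v _ => ?_)
      by_contra hc
      exact (hgsupp v u hc).elim hl hh
  have hvertex : ∀ v, A v * ρ.y v + (if F v then fb v else 0) ≤ 6 * (I.d v * ρ.y v) := by
    intro v
    by_cases hd : I.d v = 0
    · have h1 : A v = 0 := Finset.sum_eq_zero fun u _ => hroomd u v hd
      simp [h1, hfb, hov_d v hd, hd]
    obtain ⟨h7, h6⟩ := hs.card_saturated_le hI hd
    set S := (I.nbhd v).filter (IsSaturated s)
    have hLS : L v ⊆ S := fun u hu => by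
      obtain ⟨h1, h2, -⟩ := (hLmem v u).1 hu
      exact Finset.mem_filter.2 ⟨h1, Or.inl h2⟩
    have hcard : F v → (L v).card + 1 ≤ S.card := fun hFv => by
      have hm : ρ.server v ∈ S := Finset.mem_filter.2 ⟨hbmem v hd, hbsat v hd⟩
      have hn : ρ.server v ∉ L v := fun h => ((hLmem _ _).1 h).2.2 ⟨hFv, rfl⟩
      rw [← Finset.card_insert_of_notMem hn]
      exact Finset.card_le_card (Finset.insert_subset hm hLS)
    have hAle : ∀ n : ℕ, (L v).card ≤ n → A v ≤ n * I.d v := fun n hn => by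
      refine (Finset.sum_le_card_nsmul _ _ _ fun u _ => hs.room_le u v).trans ?_
      rw [nsmul_eq_mul]
      exact mul_le_mul_of_nonneg_right (by exact_mod_cast hn) (I.d_nonneg v)
    have hd0 := I.d_nonneg v
    have hAov : A v + ov v = max (I.d v) (A v) := by
      have := min_add_max (I.d v) (A v)
      simp only [hov]
      linarith
    suffices h : A v + (if F v then ov v + (if I.IsPrivate (ρ.server v) v ∧ ov v = 0 then 0
        else I.d v) else 0) ≤ 6 * I.d v by
      have h' := mul_le_mul_of_nonneg_right h (hs.y_nonneg v)
      refine le_trans (le_of_eq ?_) (h'.trans_eq (by ring))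
      simp only [hfb]
      split_ifs <;> ring
    -- With a private server there are up to six shares: the total is `A v ≤ 6 * d v` without
    -- overflow, and at most `2 * d v` with it. With any other server in `F` there are at most five
    -- shares and one copy. Outside `F` there are at most six shares and no copy.
    by_cases hFv : F v
    · rw [if_pos hFv]
      by_cases hpv : I.IsPrivate (ρ.server v) v
      · by_cases h0 : ov v = 0
        · rw [if_pos ⟨hpv, h0⟩, h0, add_zero, add_zero]
          exact_mod_cast hAle 6 (by have := hcard hFv; omega)
        · rw [if_neg fun h => h0 h.2, ← add_assoc, hAov]
          have : A v < I.d v := by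
            by_contra! hc
            exact h0 (by simp only [hov]; rw [min_eq_left hc, sub_self])
          rw [max_eq_left this.le]
          linarith
      · rw [if_neg fun h => hpv h.1, ← add_assoc, hAov]
        have h1 := hAle 5 (by have := hcard hFv; have := h6.resolve_right hpv; omega)
        have h2 : max (I.d v) (A v) ≤ 5 * I.d v := max_le (by linarith) (by exact_mod_cast h1)
        linarith
    · rw [if_neg hFv, add_zero]
      have h1 := h6.resolve_right fun h => hFv (Or.inr h)
      exact_mod_cast hAle 6 ((Finset.card_le_card hLS).trans h1)
  refine ⟨g, hadm, ?_⟩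
  calc I.cost g ≤ ∑ u, (∑ v, (if u ∈ L v then ρ.room u v * ρ.y v else 0) +
        ∑ v, (if ρ.server v = u ∧ F v then fb v else 0)) :=
        Finset.sum_le_sum fun u _ => hcharge u
    _ = ∑ v, (A v * ρ.y v + (if F v then fb v else 0)) := by
        rw [Finset.sum_add_distrib, Finset.sum_comm, Finset.sum_comm (γ := V)
          (f := fun u v => if ρ.server v = u ∧ F v then fb v else 0), ← Finset.sum_add_distrib]
        refine Finset.sum_congr rfl fun v _ => ?_
        congr 1
        · rw [Finset.sum_ite_mem, Finset.univ_inter, Finset.sum_mul]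
        · by_cases hFv : F v <;> simp [hFv]
    _ ≤ ∑ v, 6 * (I.d v * ρ.y v) := Finset.sum_le_sum fun v _ => hvertex v
    _ = 6 * ∑ v, I.d v * ρ.y v := by rw [Finset.mul_sum]
    _ ≤ 6 * I.optFractional := mul_le_mul_of_nonneg_left hs.sum_le_optFractional (by norm_num)

end CapDom

/-! ### Crossing chords of a circle -/

/-- Twice the signed area of the triangle on the unit circle with angles `x`, `y`, `z`. -/
def circleArea (x y z : ℝ) : ℝ := Real.sin (y - x) + Real.sin (z - y) - Real.sin (z - x)

/-- The area factors as four times the product of the sines of the half differences, all of which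
lie in `(0, π)`. -/
theorem circleArea_pos {x y z : ℝ} (hxy : x < y) (hyz : y < z) (hzx : z < x + 2 * Real.pi) :
    0 < circleArea x y z := by
  have h : circleArea x y z =
      4 * (Real.sin ((y - x) / 2) * Real.sin ((z - y) / 2) * Real.sin ((z - x) / 2)) := by
    obtain ⟨p, hp⟩ : ∃ p, p = (y - x) / 2 := ⟨_, rfl⟩
    obtain ⟨q, hq⟩ : ∃ q, q = (z - y) / 2 := ⟨_, rfl⟩
    have h1 : y - x = 2 * p := by linarith
    have h2 : z - y = 2 * q := by linarith
    have h3 : z - x = 2 * (p + q) := by linarith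
    have h4 : (z - x) / 2 = p + q := by linarith
    rw [circleArea, h4, ← hp, ← hq, h1, h2, h3, Real.sin_two_mul, Real.sin_two_mul,
      Real.sin_two_mul, Real.sin_add, Real.cos_add]
    have hp' := Real.sin_sq_add_cos_sq p
    have hq' := Real.sin_sq_add_cos_sq q
    have hp2 : Real.cos p ^ 2 = 1 - Real.sin p ^ 2 := by linarith
    have hq2 : Real.cos q ^ 2 = 1 - Real.sin q ^ 2 := by linarith
    ring_nf
    rw [hp2, hq2]
    ring
  rw [h]
  have h1 : 0 < Real.sin ((y - x) / 2) := Real.sin_pos_of_pos_of_lt_pi (by linarith) (by linarith)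
  have h2 : 0 < Real.sin ((z - y) / 2) := Real.sin_pos_of_pos_of_lt_pi (by linarith) (by linarith)
  have h3 : 0 < Real.sin ((z - x) / 2) := Real.sin_pos_of_pos_of_lt_pi (by linarith) (by linarith)
  positivity

/-- Two chords of a circle whose endpoints alternate along the circle meet. -/
theorem exists_mem_segment_inter {p : ℂ} {α β γ δ : ℝ} (h1 : α < β) (h2 : β < γ) (h3 : γ < δ)
    (h4 : δ < α + 2 * Real.pi) :
    (segment ℝ (p * Complex.exp (α * Complex.I)) (p * Complex.exp (γ * Complex.I)) ∩
      segment ℝ (p * Complex.exp (β * Complex.I)) (p * Complex.exp (δ * Complex.I))).Nonempty := by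
  have s1 := circleArea_pos h2 h3 (by linarith)
  have s2 := circleArea_pos (h1.trans h2) h3 (by linarith)
  have s3 := circleArea_pos h1 (h2.trans h3) (by linarith)
  have s4 := circleArea_pos h1 h2 (by linarith)
  -- Any four points of the plane satisfy an affine dependence whose coefficients are the areas of
  -- the opposite triangles. Dividing it by `a + c = b + d` gives the same point as a convex
  -- combination on each chord.
  set a := circleArea β γ δ with ha
  set b := circleArea α γ δ with hb
  set c := circleArea α β δ with hc
  set d := circleArea α β γ with hd
  have hsum : a + c = b + d := by
    simp only [ha, hb, hc, hd, circleArea]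
    ring
  have hac : 0 < a + c := by positivity
  have hcos : a * Real.cos α + c * Real.cos γ = b * Real.cos β + d * Real.cos δ := by
    simp only [ha, hb, hc, hd, circleArea, Real.sin_sub]
    ring
  have hsin : a * Real.sin α + c * Real.sin γ = b * Real.sin β + d * Real.sin δ := by
    simp only [ha, hb, hc, hd, circleArea, Real.sin_sub]
    ring
  have hexp : (a : ℂ) * Complex.exp (α * Complex.I) + c * Complex.exp (γ * Complex.I) =
      b * Complex.exp (β * Complex.I) + d * Complex.exp (δ * Complex.I) := by
    simp only [Complex.exp_mul_I, ← Complex.ofReal_cos, ← Complex.ofReal_sin]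
    have h5 : (a : ℂ) * Real.cos α + c * Real.cos γ = b * Real.cos β + d * Real.cos δ := by
      exact_mod_cast hcos
    have h6 : (a : ℂ) * Real.sin α + c * Real.sin γ = b * Real.sin β + d * Real.sin δ := by
      exact_mod_cast hsin
    linear_combination h5 + Complex.I * h6
  refine ⟨(a / (a + c) : ℝ) • (p * Complex.exp (α * Complex.I)) +
    (c / (a + c) : ℝ) • (p * Complex.exp (γ * Complex.I)), ⟨a / (a + c), c / (a + c), by positivity,
      by positivity, by field_simp, rfl⟩, ⟨b / (a + c), d / (a + c), by positivity, by positivity,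
      by rw [← add_div, ← hsum, div_self hac.ne'], ?_⟩⟩
  simp only [Complex.real_smul, Complex.ofReal_div]
  linear_combination -(p / ((a + c : ℝ) : ℂ)) * hexp

/-! ### Order and distance in an outerplanar embedding -/

namespace OuterplanarEmbedding

variable {V : Type*} {G : SimpleGraph V} (E : OuterplanarEmbedding G) (anchor : V)

theorem ccwAngle_nonneg (v : V) : 0 ≤ E.ccwAngle anchor v :=
  left_le_toIcoMod Real.two_pi_pos 0 _

theorem ccwAngle_lt (v : V) : E.ccwAngle anchor v < 2 * Real.pi :=
  (toIcoMod_lt_right Real.two_pi_pos 0 _).trans_eq (zero_add _)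

theorem pos_eq (v : V) : (E.pos v : ℂ) =
    (E.pos anchor : ℂ) * Complex.exp (E.ccwAngle anchor v * Complex.I) := by
  set q : Circle := E.pos v / E.pos anchor with hq
  have h1 : Circle.exp (E.ccwAngle anchor v) = q := by
    have h2 : E.ccwAngle anchor v = Complex.arg (q : ℂ) -
        (toIcoDiv Real.two_pi_pos 0 (Complex.arg (q : ℂ))) • (2 * Real.pi) := rfl
    rw [h2, Circle.periodic_exp.sub_zsmul_eq, Circle.exp_arg]
  have h3 : E.pos v = E.pos anchor * q := by rw [hq, mul_div_cancel]
  rw [← Circle.coe_exp, h1, h3, Circle.coe_mul]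

theorem ccwAngle_injective : Function.Injective (E.ccwAngle anchor) := fun u v h => by
  refine E.pos_injective (Subtype.ext ?_)
  have := E.pos_eq anchor u
  rw [h, ← E.pos_eq anchor v] at this
  exact this

theorem ccwAngle_anchor : E.ccwAngle anchor anchor = 0 := by
  unfold ccwAngle
  rw [div_self', Circle.coe_one, Complex.arg_one]
  exact (toIcoMod_eq_self Real.two_pi_pos).2 ⟨le_rfl, by simpa using Real.two_pi_pos⟩

theorem not_crossing {a b c d : V} (h1 : E.ccwAngle anchor a < E.ccwAngle anchor b)
    (h2 : E.ccwAngle anchor b < E.ccwAngle anchor c)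
    (h3 : E.ccwAngle anchor c < E.ccwAngle anchor d) (hac : G.Adj a c) : ¬ G.Adj b d := by
  intro hbd
  have hab : a ≠ b := fun h => h1.ne (h ▸ rfl)
  have hbc : b ≠ c := fun h => h2.ne (h ▸ rfl)
  have hcd : c ≠ d := fun h => h3.ne (h ▸ rfl)
  have had : a ≠ d := fun h => (h1.trans (h2.trans h3)).ne (h ▸ rfl)
  obtain ⟨z, hz⟩ := exists_mem_segment_inter (p := (E.pos anchor : ℂ)) h1 h2 h3 (by
    linarith [E.ccwAngle_lt anchor d, E.ccwAngle_nonneg anchor a])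
  rw [← E.pos_eq, ← E.pos_eq, ← E.pos_eq, ← E.pos_eq] at hz
  have hne : s(a, c) ≠ s(b, d) := by
    rw [Ne, Sym2.eq_iff]
    tauto
  obtain ⟨v, ⟨hv1, hv2⟩, -⟩ := E.edges_meet_at_ends a c b d hac hbd hne hz
  simp only [Set.mem_insert_iff, Set.mem_singleton_iff] at hv1 hv2
  rcases hv1 with rfl | rfl <;> rcases hv2 with rfl | rfl <;> contradiction

/-- A vertex that is separated from the anchor by an edge is farther away from it than one of the
ends of the edge. -/
theorem exists_dist_lt (hconn : G.Connected) {x y u : V} (hxy : G.Adj x y)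
    (hxu : E.ccwAngle anchor x < E.ccwAngle anchor u)
    (huy : E.ccwAngle anchor u < E.ccwAngle anchor y) :
    G.dist anchor x < G.dist anchor u ∨ G.dist anchor y < G.dist anchor u := by
  induction h : G.dist anchor u generalizing u with
  | zero =>
    have : anchor = u := (hconn.dist_eq_zero_iff).1 h
    subst this
    rw [E.ccwAngle_anchor] at hxu
    exact absurd hxu (E.ccwAngle_nonneg anchor x).not_gt
  | succ n ih =>
    obtain ⟨t, htu, htn⟩ : ∃ t, G.Adj t u ∧ G.dist anchor t = n := by
      obtain ⟨p, hp⟩ := hconn.exists_walk_length_eq_dist anchor u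
      have hl : p.length = n + 1 := hp.trans h
      refine ⟨p.getVert n, ?_, ?_⟩
      · have := p.adj_getVert_succ (i := n) (by omega)
        rwa [← hl, p.getVert_length] at this
      · have h1 : G.dist anchor (p.getVert n) ≤ n := by
          refine (SimpleGraph.dist_le (p.take n)).trans ?_
          rw [SimpleGraph.Walk.take_length]
          exact min_le_left _ _
        have h2 : G.Adj (p.getVert n) u := by
          have := p.adj_getVert_succ (i := n) (by omega)
          rwa [← hl, p.getVert_length] at this
        have h3 := hconn.dist_triangle (u := anchor) (v := p.getVert n) (w := u)
        rw [SimpleGraph.dist_eq_one_iff_adj.2 h2] at h3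
        omega
    -- The predecessor `t` of `u` on a shortest path is an end of `xy`, or is enclosed as well, or
    -- lies outside; in the last case `tu` crosses `xy`.
    rcases lt_trichotomy (E.ccwAngle anchor t) (E.ccwAngle anchor x) with h1 | h1 | h1
    · exact absurd hxy (E.not_crossing anchor h1 hxu huy htu)
    · rw [E.ccwAngle_injective anchor h1] at htn
      exact Or.inl (by omega)
    · rcases lt_trichotomy (E.ccwAngle anchor t) (E.ccwAngle anchor y) with h2 | h2 | h2
      · rcases ih h1 h2 htn with h3 | h3
        · exact Or.inl (by omega)
        · exact Or.inr (by omega)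
      · rw [E.ccwAngle_injective anchor h2] at htn
        exact Or.inr (by omega)
      · exact absurd htu.symm (E.not_crossing anchor hxu huy h2 hxy)

end OuterplanarEmbedding

/-! ### Neighbours within a layer and children in the next one -/

/-- What is used of an outerplanar embedding: `φ` orders the vertices along the outer face, `δ` is
the distance to a vertex that is not separated from the outer face by any edge. -/
structure IsLayeredOrder {V : Type*} (G : SimpleGraph V) (δ : V → ℕ) (φ : V → ℝ) : Prop where
  injective : Function.Injective φ
  not_crossing : ∀ {a b c d : V}, φ a < φ b → φ b < φ c → φ c < φ d → G.Adj a c → ¬ G.Adj b d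
  enclosed : ∀ {x y u : V}, G.Adj x y → φ x < φ u → φ u < φ y → δ x < δ u ∨ δ y < δ u

theorem OuterplanarEmbedding.isLayeredOrder {V : Type*} {G : SimpleGraph V}
    (E : OuterplanarEmbedding G) (hconn : G.Connected) (anchor : V) :
    IsLayeredOrder G (G.dist anchor) (E.ccwAngle anchor) :=
  ⟨E.ccwAngle_injective anchor, E.not_crossing anchor, E.exists_dist_lt anchor hconn⟩

theorem SimpleGraph.Connected.dist_le_succ_of_adj {V : Type*} {G : SimpleGraph V}
    (hconn : G.Connected) (a : V) {u v : V} (h : G.Adj u v) : G.dist a v ≤ G.dist a u + 1 := by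
  have := hconn.dist_triangle (u := a) (v := u) (w := v)
  rwa [SimpleGraph.dist_eq_one_iff_adj.2 h] at this

namespace IsLayeredOrder

variable {V : Type*} {G : SimpleGraph V} {δ : V → ℕ} {φ : V → ℝ}

/-- Reflection, which turns statements about the left side into ones about the right side. -/
theorem neg (h : IsLayeredOrder G δ φ) : IsLayeredOrder G δ fun v => -φ v where
  injective := fun _ _ huv => h.injective (neg_injective huv)
  not_crossing := fun h1 h2 h3 hac hbd => h.not_crossing (neg_lt_neg_iff.1 h3) (neg_lt_neg_iff.1 h2)
    (neg_lt_neg_iff.1 h1) hbd.symm hac.symm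
  enclosed := fun hxy h1 h2 =>
    (h.enclosed hxy.symm (neg_lt_neg_iff.1 h2) (neg_lt_neg_iff.1 h1)).symm

/-- Otherwise the longer of the two edges at `u` encloses the end of the shorter one, although
neither of its ends is closer to the anchor. -/
theorem eq_of_adj_of_lt (h : IsLayeredOrder G δ φ) {u x y : V} (hx : G.Adj u x) (hy : G.Adj u y)
    (hxy : δ x = δ y) (hu : δ x ≤ δ u) (hxu : φ x < φ u) (hyu : φ y < φ u) : x = y := by
  rcases lt_trichotomy (φ x) (φ y) with h1 | h1 | h1
  · rcases h.enclosed hx.symm h1 hyu with h2 | h2 <;> omega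
  · exact h.injective h1
  · rcases h.enclosed hy.symm h1 hxu with h2 | h2 <;> omega

theorem card_le_two (h : IsLayeredOrder G δ φ) {u : V} {k : ℕ} (hk : k ≤ δ u) (S : Finset V)
    (hS : ∀ x ∈ S, G.Adj u x ∧ δ x = k) : S.card ≤ 2 := by
  classical
  have h1 : (S.filter fun x => φ x < φ u).card ≤ 1 := by
    refine Finset.card_le_one.2 fun x hx y hy => ?_
    rw [Finset.mem_filter] at hx hy
    obtain ⟨hx1, hx2⟩ := hS x hx.1
    obtain ⟨hy1, hy2⟩ := hS y hy.1
    exact h.eq_of_adj_of_lt hx1 hy1 (by omega) (by omega) hx.2 hy.2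
  have h2 : (S.filter fun x => ¬ φ x < φ u).card ≤ 1 := by
    have h3 : ∀ x, G.Adj u x → ¬ φ x < φ u → -φ x < -φ u := fun x hx hn =>
      neg_lt_neg ((not_lt.1 hn).lt_of_ne fun hc => hx.ne (h.injective hc))
    refine Finset.card_le_one.2 fun x hx y hy => ?_
    rw [Finset.mem_filter] at hx hy
    obtain ⟨hx1, hx2⟩ := hS x hx.1
    obtain ⟨hy1, hy2⟩ := hS y hy.1
    exact h.neg.eq_of_adj_of_lt hx1 hy1 (by omega) (by omega) (h3 x hx1 hx.2) (h3 y hy1 hy.2)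
  rw [← Finset.card_filter_add_card_filter_not (s := S) fun x => φ x < φ u]
  omega

/-- A common child of two vertices of a layer lies between them. -/
theorem between (h : IsLayeredOrder G δ φ) {v x u : V} (hv : G.Adj v u) (hx : G.Adj x u)
    (hu : δ u = δ v + 1) (hxv : δ x = δ v) (hlt : φ x < φ v) : φ x < φ u ∧ φ u < φ v := by
  constructor
  · rcases lt_trichotomy (φ x) (φ u) with h1 | h1 | h1
    · exact h1
    · exact absurd (h.injective h1) hx.ne
    · rcases h.enclosed hv.symm h1 hlt with h2 | h2 <;> omega
  · rcases lt_trichotomy (φ u) (φ v) with h1 | h1 | h1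
    · exact h1
    · exact absurd (h.injective h1).symm hv.ne
    · rcases h.enclosed hx hlt h1 with h2 | h2 <;> omega

/-- At most one child of `v` has another parent before `v`. -/
theorem shared_child_unique (h : IsLayeredOrder G δ φ) {v x u x' u' : V} (hv : G.Adj v u)
    (hx : G.Adj x u) (hu : δ u = δ v + 1) (hxv : δ x = δ v) (hlt : φ x < φ v) (hv' : G.Adj v u')
    (hx' : G.Adj x' u') (hu' : δ u' = δ v + 1) (hxv' : δ x' = δ v) (hlt' : φ x' < φ v) :
    u = u' := by
  -- Suppose `u'` precedes `u`. If `u'` also precedes `x`, the edge `u'v` encloses `x`, which is not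
  -- farther away than `v`; otherwise `xu` and `u'v` cross. The opposite order is symmetric.
  have key : ∀ {x u x' u' : V}, G.Adj v u → G.Adj x u → δ u = δ v + 1 → δ x = δ v → φ x < φ v →
      G.Adj v u' → G.Adj x' u' → δ u' = δ v + 1 → δ x' = δ v → φ x' < φ v → ¬ φ u' < φ u := by
    intro x u x' u' hv hx hu hxv hlt hv' hx' hu' hxv' hlt' hc
    obtain ⟨h1, h2⟩ := h.between hv hx hu hxv hlt
    rcases lt_trichotomy (φ u') (φ x) with h3 | h3 | h3
    · rcases h.enclosed hv'.symm h3 hlt with h4 | h4 <;> omega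
    · have := h.injective h3
      subst this
      omega
    · exact h.not_crossing h3 hc h2 hx hv'.symm
  rcases lt_trichotomy (φ u) (φ u') with h1 | h1 | h1
  · exact absurd h1 (key hv' hx' hu' hxv' hlt' hv hx hu hxv hlt)
  · exact h.injective h1
  · exact absurd h1 (key hv hx hu hxv hlt hv' hx' hu' hxv' hlt')

/-- The parent before `v` of a child of `v` is the neighbour of `v` in the layer of `v`. -/
theorem shared_parent_eq (h : IsLayeredOrder G δ φ) {v x u l : V} (hv : G.Adj v u)
    (hx : G.Adj x u) (hu : δ u = δ v + 1) (hxv : δ x = δ v) (hlt : φ x < φ v) (hl : G.Adj v l)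
    (hlv : δ l = δ v) (hlt' : φ l < φ v) : x = l := by
  obtain ⟨h1, h2⟩ := h.between hv hx hu hxv hlt
  rcases lt_trichotomy (φ x) (φ l) with h3 | h3 | h3
  · rcases lt_trichotomy (φ l) (φ u) with h4 | h4 | h4
    · rcases h.enclosed hx h3 h4 with h5 | h5 <;> omega
    · have := h.injective h4
      subst this
      omega
    · rcases h.enclosed hv.symm h4 hlt' with h5 | h5 <;> omega
  · exact h.injective h3
  · rcases h.enclosed hl.symm h3 hlt with h5 | h5 <;> omega

end IsLayeredOrder

/-! ### Sparsity of the reduced instance -/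

namespace CapDom

variable {V : Type*} [Fintype V] {I : CapDom V} {E : OuterplanarEmbedding I.graph} {anchor : V}
  {i : ℕ} {C : I.ReductionChoice}

theorem adj_of_reduced {a b : V} (h : (I.reduced E anchor i C).graph.Adj a b) : I.graph.Adj a b :=
  (SimpleGraph.deleteEdges_adj.1 h).1.1

theorem mem_classR_of_demand {v : V} (h : (I.reduced E anchor i C).d v ≠ 0) :
    v ∈ I.classR anchor i := Set.mem_of_indicator_ne_zero h

theorem not_mem_removed {v x : V} (hv : v ∈ I.classR anchor i)
    (h : (I.reduced E anchor i C).graph.Adj v x) : x ∉ I.removed E anchor C v := fun hx =>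
  (SimpleGraph.deleteEdges_adj.1 h).2 ⟨v, hv, x, hx, Sym2.eq_swap⟩

open scoped Classical in
/-- At most four neighbours outside of the own layer are kept. -/
theorem card_other_layers_le {v : V} (hv : v ∈ I.classR anchor i) :
    (((I.reduced E anchor i C).nbhd v).filter fun x =>
      I.graph.dist anchor x ≠ I.graph.dist anchor v).card ≤ 4 := by
  set H := I.reduced E anchor i C
  have hJ : ((H.nbhd v).filter (I.IsFirstLarge C v)).card ≤ 1 := by
    refine Finset.card_le_one.2 fun x hx y hy => ?_
    have hx := (Finset.mem_filter.1 hx).2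
    have hy := (Finset.mem_filter.1 hy).2
    exact Option.some_injective _ (hx.symm.trans hy)
  have hK : ((H.nbhd v).filter (I.IsBestRatio C v)).card ≤ 1 := by
    refine Finset.card_le_one.2 fun x hx y hy => ?_
    exact (Finset.mem_filter.1 hx).2.2.trans (Finset.mem_filter.1 hy).2.2.symm
  have hP : ((H.nbhd v).filter (I.IsLastUp E anchor v)).card ≤ 1 := by
    refine Finset.card_le_one.2 fun x hx y hy => ?_
    exact E.ccwAngle_injective anchor
      ((Finset.mem_filter.1 hx).2.1.unique (Finset.mem_filter.1 hy).2.1)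
  have hQ : ((H.nbhd v).filter (I.IsLastDown E anchor v)).card ≤ 1 := by
    refine Finset.card_le_one.2 fun x hx y hy => ?_
    exact E.ccwAngle_injective anchor
      ((Finset.mem_filter.1 hx).2.1.unique (Finset.mem_filter.1 hy).2.1)
  have hsub : ((H.nbhd v).filter fun x => I.graph.dist anchor x ≠ I.graph.dist anchor v) ⊆
      ((H.nbhd v).filter (I.IsFirstLarge C v) ∪ (H.nbhd v).filter (I.IsBestRatio C v)) ∪
      ((H.nbhd v).filter (I.IsLastUp E anchor v) ∪
        (H.nbhd v).filter (I.IsLastDown E anchor v)) := by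
    intro x hx
    obtain ⟨hx, hne⟩ := Finset.mem_filter.1 hx
    have hadj : H.graph.Adj v x := (mem_nbhd.1 hx).resolve_left fun h => hne (by rw [h])
    have h1 := not_mem_removed hv hadj
    have h2 : x ∈ I.nbhd v := mem_nbhd.2 (Or.inr (adj_of_reduced hadj))
    simp only [removed, Set.mem_ofPred_eq] at h1
    simp only [Finset.mem_union, Finset.mem_filter]
    tauto
  have h1 := Finset.card_le_card hsub
  have h2 := Finset.card_union_le
    ((H.nbhd v).filter (I.IsFirstLarge C v) ∪ (H.nbhd v).filter (I.IsBestRatio C v))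
    ((H.nbhd v).filter (I.IsLastUp E anchor v) ∪ (H.nbhd v).filter (I.IsLastDown E anchor v))
  have h3 := Finset.card_union_le ((H.nbhd v).filter (I.IsFirstLarge C v))
    ((H.nbhd v).filter (I.IsBestRatio C v))
  have h4 := Finset.card_union_le ((H.nbhd v).filter (I.IsLastUp E anchor v))
    ((H.nbhd v).filter (I.IsLastDown E anchor v))
  omega

theorem reduced_isSparse (hconn : I.graph.Connected) : (I.reduced E anchor i C).IsSparse := by
  classical
  set H := I.reduced E anchor i C with hH
  intro v hd
  have hv : I.graph.dist anchor v % 3 = i := mem_classR_of_demand hd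
  set δ : V → ℕ := I.graph.dist anchor with hδ
  set φ : V → ℝ := E.ccwAngle anchor with hφ
  have hO : IsLayeredOrder I.graph δ φ := E.isLayeredOrder hconn anchor
  have hadj : ∀ {a b}, b ∈ H.nbhd a → b ≠ a → I.graph.Adj a b := fun h hne =>
    adj_of_reduced ((mem_nbhd.1 h).resolve_left hne)
  have hdist : ∀ {a b}, I.graph.Adj a b → δ a ≤ δ b + 1 ∧ δ b ≤ δ a + 1 := fun h =>
    ⟨hconn.dist_le_succ_of_adj anchor h.symm, hconn.dist_le_succ_of_adj anchor h⟩
  have hclass : ∀ {x}, H.d x ≠ 0 → δ x % 3 = i := fun h => mem_classR_of_demand h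
  set S := (H.nbhd v).filter fun x => δ x = δ v
  set T := (H.nbhd v).filter fun x => ¬ δ x = δ v with hT
  set U := T.filter fun x => δ x < δ v
  set W := T.filter fun x => ¬ δ x < δ v with hW
  have hST : S.card + T.card = (H.nbhd v).card := Finset.card_filter_add_card_filter_not _
  have hUW : U.card + W.card = T.card := Finset.card_filter_add_card_filter_not _
  have hT4 : T.card ≤ 4 := card_other_layers_le hv
  have hvS : v ∈ S := Finset.mem_filter.2 ⟨self_mem_nbhd v, rfl⟩
  have hSl : ∀ x ∈ S.erase v, I.graph.Adj v x ∧ δ x = δ v := fun x hx => by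
    obtain ⟨hxv, hx⟩ := Finset.mem_erase.1 hx
    obtain ⟨hx, h1⟩ := Finset.mem_filter.1 hx
    exact ⟨hadj hx hxv, h1⟩
  have hS2 : (S.erase v).card ≤ 2 := hO.card_le_two le_rfl _ hSl
  have hS1 := Finset.card_erase_add_one hvS
  have hU2 : U.card ≤ 2 := by
    refine hO.card_le_two (u := v) (k := δ v - 1) (Nat.sub_le _ _) _ fun x hx => ?_
    obtain ⟨hx, h1⟩ := Finset.mem_filter.1 hx
    have h2 := hadj (Finset.mem_filter.1 hx).1 (by rintro rfl; omega)
    have := hdist h2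
    exact ⟨h2, by omega⟩
  -- Seven is `v` itself, two neighbours in its layer and four in other layers.
  refine ⟨by omega, ?_⟩
  by_cases h6 : (H.nbhd v).card ≤ 6
  · exact Or.inl h6
  by_cases hpriv : ∃ z ∈ H.nbhd v, H.IsPrivate z v
  · exact Or.inr (Or.inl hpriv)
  refine Or.inr (Or.inr ?_)
  have hchild : ∀ w ∈ W, w ∈ H.nbhd v ∧ I.graph.Adj v w ∧ δ w = δ v + 1 := by
    intro w hw
    obtain ⟨hw, h1⟩ := Finset.mem_filter.1 hw
    obtain ⟨hw, h2⟩ := Finset.mem_filter.1 hw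
    have h3 := hadj hw (by rintro rfl; exact h2 rfl)
    have := hdist h3
    exact ⟨hw, h3, by omega⟩
  -- Demand sits only in layers congruent to `i` modulo 3, so the demand that reaches a child of `v`
  -- comes from the layer of `v`.
  have hparent : ∀ w ∈ W, ∀ x ∈ H.nbhd w, H.d x ≠ 0 → I.graph.Adj x w ∧ δ x = δ v := by
    intro w hw x hx hxd
    obtain ⟨-, -, h1⟩ := hchild w hw
    have h2 := hclass hxd
    have h3 : I.graph.Adj w x := hadj hx (by rintro rfl; omega)
    have := hdist h3
    exact ⟨h3.symm, by omega⟩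
  have hshared : ∀ w ∈ W, ∃ x ∈ H.nbhd w, H.d x ≠ 0 ∧ x ≠ v := by
    intro w hw
    by_contra! hc
    exact hpriv ⟨w, (hchild w hw).1, hc⟩
  -- Seven closed neighbours force both neighbours in the layer to exist, one on each side of `v`.
  have hsides : (∃ l ∈ S.erase v, φ l < φ v) ∧ ∃ r ∈ S.erase v, φ v < φ r := by
    have h2 : 1 < (S.erase v).card := by omega
    obtain ⟨x, hx, y, hy, hxy⟩ := Finset.one_lt_card.1 h2
    obtain ⟨hx1, hx2⟩ := hSl x hx
    obtain ⟨hy1, hy2⟩ := hSl y hy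
    have hne : ∀ {z}, I.graph.Adj v z → φ z ≠ φ v := fun hz hc => hz.ne (hO.injective hc).symm
    rcases lt_or_gt_of_ne (hne hx1) with h3 | h3 <;> rcases lt_or_gt_of_ne (hne hy1) with h4 | h4
    · exact absurd (hO.eq_of_adj_of_lt hx1 hy1 (by omega) (by omega) h3 h4) hxy
    · exact ⟨⟨x, hx, h3⟩, y, hy, h4⟩
    · exact ⟨⟨y, hy, h4⟩, x, hx, h3⟩
    · exact absurd (hO.neg.eq_of_adj_of_lt hx1 hy1 (by omega) (by omega) (neg_lt_neg h3)
        (neg_lt_neg h4)) hxy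
  -- A child shared to the left sees only the demands of `v` and of its left neighbour `l`, and it
  -- does see that of `l`. Used for `φ` and for its reflection.
  have key : ∀ (ψ : V → ℝ), IsLayeredOrder I.graph δ ψ → (∃ l ∈ S.erase v, ψ l < ψ v) →
      ∀ w ∈ W, ∀ x ∈ H.nbhd w, H.d x ≠ 0 → ψ x < ψ v →
      (∀ y ∈ H.nbhd w, H.d y ≠ 0 → y ∈ H.nbhd v) ∧
      ∀ y ∈ H.nbhd v, H.d y ≠ 0 → ψ y < ψ v → y ∈ H.nbhd w := by
    rintro ψ hψ ⟨l, hl, hlv⟩ w hw x hx hxd hxv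
    obtain ⟨-, h1, h2⟩ := hchild w hw
    obtain ⟨h3, h4⟩ := hparent w hw x hx hxd
    obtain ⟨hl1, hl2⟩ := hSl l hl
    have hxl : x = l := hψ.shared_parent_eq h1 h3 h2 h4 hxv hl1 hl2 hlv
    refine ⟨fun y hy hyd => ?_, fun y hy hyd hyv => ?_⟩
    · obtain ⟨h5, h6⟩ := hparent w hw y hy hyd
      have h7 := (hψ.between h1 h3 h2 h4 hxv)
      rcases lt_trichotomy (ψ y) (ψ v) with h8 | h8 | h8
      · rw [hψ.shared_parent_eq h1 h5 h2 h6 h8 hl1 hl2 hlv]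
        exact (Finset.mem_filter.1 (Finset.mem_of_mem_erase hl)).1
      · rw [hψ.injective h8]
        exact self_mem_nbhd v
      · have := hψ.between h5 h1 (by omega) h6.symm h8
        exact absurd this.1 h7.2.not_gt
    · have hy1 : I.graph.Adj v y := hadj hy (by rintro rfl; exact lt_irrefl _ hyv)
      have := hdist hy1
      have h5 := hclass hyd
      rw [← hψ.eq_of_adj_of_lt hl1 hy1 (by omega) (by omega) hlv hyv, ← hxl]
      exact hx
  have hfinal : ∀ w ∈ W, ∀ x ∈ H.nbhd w, H.d x ≠ 0 → φ x < φ v →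
      ∀ w' ∈ W, ∀ x' ∈ H.nbhd w', H.d x' ≠ 0 → φ v < φ x' → w ≠ w' →
      ∃ q ∈ H.nbhd v, ∃ r ∈ H.nbhd v, q ≠ v ∧ r ≠ v ∧ q ≠ r ∧
      (∀ x ∈ H.nbhd q, H.d x ≠ 0 → x ∈ H.nbhd v) ∧ (∀ x ∈ H.nbhd r, H.d x ≠ 0 → x ∈ H.nbhd v) ∧
      ∀ x ∈ H.nbhd v, H.d x ≠ 0 → x ∈ H.nbhd q ∨ x ∈ H.nbhd r := by
    intro w hw x hx hxd hxv w' hw' x' hx' hxd' hxv' hne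
    obtain ⟨h1, h2⟩ := key φ hO hsides.1 w hw x hx hxd hxv
    obtain ⟨h3, h4⟩ := key (fun v => -φ v) hO.neg
      (by obtain ⟨r, hr, hrv⟩ := hsides.2; exact ⟨r, hr, neg_lt_neg hrv⟩) w' hw' x' hx' hxd'
      (neg_lt_neg hxv')
    refine ⟨w, (hchild w hw).1, w', (hchild w' hw').1, (hchild w hw).2.1.ne',
      (hchild w' hw').2.1.ne', hne, h1, h3, fun y hy hyd => ?_⟩
    rcases lt_trichotomy (φ y) (φ v) with h8 | h8 | h8
    · exact Or.inl (h2 y hy hyd h8)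
    · rw [hO.injective h8]
      exact Or.inl (mem_nbhd_comm.1 (hchild w hw).1)
    · exact Or.inr (h4 y hy hyd (neg_lt_neg h8))
  -- Of the four neighbours outside the layer at most two are in the preceding one. Two children
  -- shared on the same side would coincide.
  have hW2 : 1 < W.card := by omega
  obtain ⟨w, hw, w', hw', hne⟩ := Finset.one_lt_card.1 hW2
  obtain ⟨x, hx, hxd, hxv⟩ := hshared w hw
  obtain ⟨x', hx', hxd', hxv'⟩ := hshared w' hw'
  obtain ⟨-, a1, a2⟩ := hchild w hw
  obtain ⟨-, a1', a2'⟩ := hchild w' hw'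
  obtain ⟨b1, b2⟩ := hparent w hw x hx hxd
  obtain ⟨b1', b2'⟩ := hparent w' hw' x' hx' hxd'
  rcases lt_or_gt_of_ne (fun h => hxv (hO.injective h) : φ x ≠ φ v) with h1 | h1 <;>
    rcases lt_or_gt_of_ne (fun h => hxv' (hO.injective h) : φ x' ≠ φ v) with h2 | h2
  · exact absurd (hO.shared_child_unique a1 b1 a2 b2 h1 a1' b1' a2' b2' h2) hne
  · exact hfinal w hw x hx hxd h1 w' hw' x' hx' hxd' h2 hne
  · exact hfinal w' hw' x' hx' hxd' h2 w hw x hx hxd h1 hne.symm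
  · exact absurd (hO.neg.shared_child_unique a1 b1 a2 b2 (neg_lt_neg h1) a1' b1' a2' b2'
      (neg_lt_neg h2)) hne

end CapDom

end

theorem mainTheorem5 {V : Type*} [Fintype V] (I : CapDom V) (hconn : I.graph.Connected)
    (E : OuterplanarEmbedding I.graph) (anchor : V) (i : ℕ) (hi : i < 3)
    (C : I.ReductionChoice) :
    (∃ s, (I.reduced E anchor i C).GreedyRun s) ∧
    ∀ s, (I.reduced E anchor i C).GreedyRun s →
      ∃ f : V → V → ℝ,
        (I.reduced E anchor i C).IsFeasible f ∧
        (∀ v u, f v u ≠ 0 → u ∈ s.light ∨ u ∈ s.heavy) ∧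
        (∀ u ∈ s.light, (I.reduced E anchor i C).multiplicity f u ≤ 1) ∧
        (I.reduced E anchor i C).cost f ≤
          (I.reduced E anchor i C).cost ((I.reduced E anchor i C).greedyOutput s) ∧
        (I.reduced E anchor i C).cost f ≤ 6 * (I.reduced E anchor i C).optFractional := by
  refine ⟨CapDom.exists_greedyRun _, fun s hs => ?_⟩
  obtain ⟨hp, ρ, hd⟩ := hs.invariants
  obtain ⟨g, hg, hg6⟩ :=
    CapDom.exists_admissible_le_six (CapDom.reduced_isSparse hconn) hp hd hs.2
  have h0 := hp.isAdmissible_greedyOutput hs.2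
  -- The output is itself admissible, so the cheaper of the two assignments meets both bounds.
  rcases le_total ((I.reduced E anchor i C).cost g)
    ((I.reduced E anchor i C).cost ((I.reduced E anchor i C).greedyOutput s)) with h | h
  · exact ⟨g, hg.feasible, hg.support, hg.light, h, hg6⟩
  · exact ⟨_, h0.feasible, h0.support, h0.light, le_rfl, h.trans hg6⟩
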